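/- Let $n,k\ge 1$ and let $X$ be a connected complex manifold of dimension $n+k$ that is a holomorphic fiber bundle with fiber $\mathbb{C}^k$, in the following sense: $X$ has a locally finite open cover $\{X_s\}_{s\in S}$ with biholomorphic charts $X_s\to U_s\times\mathbb{C}^k$, $x\mapsto(z,w)=(z_1,\dots,z_n,w_1,\dots,w_k)$, where $U_s\subset\mathbb{C}^n$ is a domain, and the transition maps have the form $(z_s,w_s)=(f_{st}(z_t),g_{st}(z_t,w_t))$, where $g_{st}(z_t,\cdot)$ is a biholomorphism of $\mathbb{C}^k$ onto itself. Let $\omega$ be a $\bar\partial$-closed $(0,1)$-form on $X$ of class $C^1$, written in each chart as $\omega=\sum_{\alpha=1}^n a_\alpha\,d\bar z_\alpha+\sum_{\gamma=1}^k b_\gamma\,d\bar w_\gamma$. Suppose that $\omega$ decreases along the fibers: for each chart $X_s\cong U_s\times\mathbb{C}^k$ and each compact $K\subset U_s$, one has $a_\alpha(z,w)\to0$ as $|w|\to\infty$, uniformly in $z\in K$, for every $\alpha$, and there are $\varepsilon>0$ and $C$ such that for all $\gamma$, all $z\in K$ and all $w\in\mathbb{C}^k$ $$|b_\gamma(z,w)|\le\frac{C}{1+\sum_{j=1}^k|w_j|^{1+\varepsilon}},\qquad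 |Db_\gamma(z,w)|\le\frac{C}{1+\sum_{j=1}^k|w_j|^{1+\varepsilon}}\qquad(*)$$ for every first-order partial derivative $D$ with respect to the real and imaginary parts of the coordinates $z_\beta$, $w_\delta$. Then there is a $C^1$ function $B:X\to\mathbb{C}$ with the following properties. 1. $\bar\partial B=\omega$ on $X$. 2. In each chart and for every $\delta\in\{1,\dots,k\}$, $$B(z,w)=\frac1{2\pi i}\int_{\mathbb{C}}\frac{b_\delta(z,w_1,\dots,w_{\delta-1},\zeta,w_{\delta+1},\dots,w_k)}{\zeta-w_\delta}\,d\zeta\wedge d\bar\zeta ,$$ the integral being absolutely convergent. 3. For each chart $X_s$, each compact $K\subset U_s$ and all $\varepsilon>0$ and $C$ for which $(*)$ holds on $K$, there is a constant $C'$ such that for all $z\in K$, $w\in\mathbb{C}^k$ and $\delta\in\{1,\dots,k\}$ $$|B(z,w)|\le C'\int_{\mathbb{C}}\frac1{|\zeta|}\cdot\frac{1}{1+\sum_{\gamma\ne\delta}|w_\gamma|^{1+\varepsilon}+|w_\delta+\zeta|^{1+\varepsilon}}\,|d\zeta\wedge d\bar\zeta|<\infty .$$ 4. For each chart $X_s$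 and each compact $K\subset U_s$, $B$ is bounded on $K\times\mathbb{C}^k$. 5. For each chart $X_s$, each compact $K\subset U_s$ and each $\delta$, $B(z,w)\to0$ as $|w_\delta|\to\infty$, uniformly in $z\in K$ and in the remaining variables $w_\gamma$, $\gamma\ne\delta$. -/

import Mathlib

open scoped Manifold ContDiff

noncomputable section

/-- The model space `ℂⁿ × ℂᵏ` with coordinates `(z, w)`. -/
abbrev ZW (n k : ℕ) : Type := (Fin n → ℂ) × (Fin k → ℂ)

/-- The coordinate vector of `z_β` multiplied by `c`; for `c = 1` it is the direction of
`x_β = Re z_β`, for `c = i` the direction of `y_β = Im z_β`. -/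
def zDir {n k : ℕ} (β : Fin n) (c : ℂ) : ZW n k := (Pi.single β c, 0)

/-- The coordinate vector of `w_γ` multiplied by `c`; for `c = 1` it is the direction of
`u_γ = Re w_γ`, for `c = i` the direction of `v_γ = Im w_γ`. -/
def wDir {n k : ℕ} (γ : Fin k) (c : ℂ) : ZW n k := (0, Pi.single γ c)

/-- The directions of the real coordinates `x_β, y_β, u_γ, v_γ`. -/
def realCoordDirs (n k : ℕ) : Set (ZW n k) :=
  {v | (∃ β : Fin n, v = zDir β 1 ∨ v = zDir β Complex.I) ∨
       (∃ γ : Fin k, v = wDir γ 1 ∨ v = wDir γ Complex.I)}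

/-- The conjugate-linear part `v ↦ (L v + i L (i v)) / 2` of a real-linear form `L`. -/
def antilinearPart {n k : ℕ} (L : ZW n k →L[ℝ] ℂ) : ZW n k →L⋆[ℂ] ℂ where
  toFun v := (1 / 2 : ℂ) * (L v + Complex.I * L (Complex.I • v))
  map_add' u v := by simp only [smul_add, map_add]; ring
  map_smul' c v := by
    have h : ∀ (a : ℂ) (x : ZW n k),
        L (a • x) = (a.re : ℂ) * L x + (a.im : ℂ) * L (Complex.I • x) := by
      intro a x
      have e : a • x = a.re • x + a.im • (Complex.I • x) := by
        ext i <;> simp <;> nth_rewrite 1 [← Complex.re_add_im a] <;> ring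
      rw [e, map_add, map_smul, map_smul, Complex.real_smul, Complex.real_smul]
    rw [smul_smul, h c v, h (Complex.I * c) v]
    have hc : (starRingEnd ℂ) c = (c.re : ℂ) - (c.im : ℂ) * Complex.I := by
      apply Complex.ext <;> simp
    simp only [hc, smul_eq_mul, Complex.mul_re, Complex.mul_im, Complex.I_re, Complex.I_im]
    push_cast
    ring_nf
    simp only [Complex.I_sq]
    ring
  cont := by fun_prop

/-- The Wirtinger derivative `∂f/∂z̄_β` at `p`. -/
def dzbar {n k : ℕ} (β : Fin n) (f : ZW n k → ℂ) (p : ZW n k) : ℂ :=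
  antilinearPart (fderiv ℝ f p) (zDir β 1)

/-- The Wirtinger derivative `∂f/∂w̄_γ` at `p`. -/
def dwbar {n k : ℕ} (γ : Fin k) (f : ZW n k → ℂ) (p : ZW n k) : ℂ :=
  antilinearPart (fderiv ℝ f p) (wDir γ 1)

/-- The Euclidean length `|w| = (|w_1|² + ⋯ + |w_k|²)^{1/2}`. -/
def euclLength {k : ℕ} (w : Fin k → ℂ) : ℝ := Real.sqrt (∑ γ, ‖w γ‖ ^ 2)

/-- `g` is a biholomorphism of `ℂᵏ` onto itself. -/
def IsBiholomorphic {k : ℕ} (g : (Fin k → ℂ) → (Fin k → ℂ)) : Prop :=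
  Differentiable ℂ g ∧ ∃ h : (Fin k → ℂ) → (Fin k → ℂ),
    Differentiable ℂ h ∧ Function.LeftInverse h g ∧ Function.RightInverse h g

/-- The structure of a holomorphic fiber bundle with fiber `ℂᵏ` and `n`-dimensional base on the
complex manifold `X`: a locally finite cover by holomorphic charts onto `U_s × ℂᵏ`, with `U_s` a
domain in `ℂⁿ`, whose transition maps have the form `(z, w) ↦ (f z, g (z, w))`, where `g (z, ·)` is
a biholomorphism of `ℂᵏ`. -/
structure HolomorphicFiberBundle (n k : ℕ) (X : Type*) [TopologicalSpace X]
    [ChartedSpace (ZW n k) X] (S : Type*) where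
  /-- the chart `X_s → U_s × ℂᵏ`; its source is `X_s` -/
  chart : S → OpenPartialHomeomorph X (ZW n k)
  /-- the domain `U_s` -/
  U : S → Set (Fin n → ℂ)
  /-- the charts belong to the complex structure of `X` -/
  chart_mem : ∀ s, chart s ∈ IsManifold.maximalAtlas 𝓘(ℂ, ZW n k) ω X
  isOpen_U : ∀ s, IsOpen (U s)
  isConnected_U : ∀ s, IsConnected (U s)
  target_eq : ∀ s, (chart s).target = U s ×ˢ Set.univ
  cover : ∀ x : X, ∃ s, x ∈ (chart s).source
  locallyFinite : LocallyFinite fun s => (chart s).source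
  transition : ∀ s t, ∃ (f : (Fin n → ℂ) → (Fin n → ℂ))
      (g : (Fin n → ℂ) → (Fin k → ℂ) → (Fin k → ℂ)),
    ∀ x ∈ (chart s).source ∩ (chart t).source,
      IsBiholomorphic (g (chart t x).1) ∧
      ∀ w : Fin k → ℂ,
        (chart t).symm ((chart t x).1, w) ∈ (chart s).source ∧
        chart s ((chart t).symm ((chart t x).1, w)) = (f (chart t x).1, g (chart t x).1 w)

/-- A (0,1)-form on `X`: a conjugate-linear form on every tangent space. -/
abbrev ZeroOneForm (n k : ℕ) (X : Type*) [TopologicalSpace X] [ChartedSpace (ZW n k) X] :=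
  ∀ x : X, TangentSpace 𝓘(ℂ, ZW n k) x →L⋆[ℂ] ℂ

/-- The (0,1)-form `∂̄B` of a function `B`: the conjugate-linear part of its real differential. -/
def dbar {n k : ℕ} {X : Type*} [TopologicalSpace X] [ChartedSpace (ZW n k) X]
    (B : X → ℂ) : ZeroOneForm n k X :=
  fun x => antilinearPart (mfderiv 𝓘(ℝ, ZW n k) 𝓘(ℝ, ℂ) B x)

namespace HolomorphicFiberBundle

variable {n k : ℕ} {X : Type*} [TopologicalSpace X] [ChartedSpace (ZW n k) X] {S : Type*}

/-- The value of the (0,1)-form `η`, read in the chart `s`, at the point `p` and on the vector `v`. -/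
def formInChart (F : HolomorphicFiberBundle n k X S) (η : ZeroOneForm n k X) (s : S)
    (p : ZW n k) (v : ZW n k) : ℂ :=
  η ((F.chart s).symm p)
    (mfderiv 𝓘(ℂ, ZW n k) 𝓘(ℂ, ZW n k) (F.chart s).symm p v)

/-- The coefficient `a_α` of `dz̄_α` of the form `η` in the chart `s`. -/
def aCoeff (F : HolomorphicFiberBundle n k X S) (η : ZeroOneForm n k X) (s : S) (α : Fin n)
    (p : ZW n k) : ℂ :=
  F.formInChart η s p (zDir α 1)

/-- The coefficient `b_γ` of `dw̄_γ` of the form `η` in the chart `s`. -/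
def bCoeff (F : HolomorphicFiberBundle n k X S) (η : ZeroOneForm n k X) (s : S) (γ : Fin k)
    (p : ZW n k) : ℂ :=
  F.formInChart η s p (wDir γ 1)

/-- The form is of class `C¹`: its coefficients in the charts are. -/
def IsC1Form (F : HolomorphicFiberBundle n k X S) (η : ZeroOneForm n k X) : Prop :=
  ∀ s, (∀ α, ContDiffOn ℝ 1 (F.aCoeff η s α) (F.chart s).target) ∧
    ∀ γ, ContDiffOn ℝ 1 (F.bCoeff η s γ) (F.chart s).target

/-- `∂̄η = 0`, written out in the charts. -/
def IsDbarClosed (F : HolomorphicFiberBundle n k X S) (η : ZeroOneForm n k X) : Prop :=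
  ∀ s, ∀ p ∈ (F.chart s).target,
    (∀ α β, dzbar β (F.aCoeff η s α) p = dzbar α (F.aCoeff η s β) p) ∧
    (∀ α γ, dwbar γ (F.aCoeff η s α) p = dzbar α (F.bCoeff η s γ) p) ∧
    (∀ γ δ, dwbar δ (F.bCoeff η s γ) p = dwbar γ (F.bCoeff η s δ) p)

/-- In the chart `s`, the coefficients `b_γ` and their first-order real partial derivatives are
bounded by `C / (1 + |w_1|^{1+ε} + ⋯ + |w_k|^{1+ε})` for `z ∈ K`. -/
def BDecay (F : HolomorphicFiberBundle n k X S) (η : ZeroOneForm n k X) (s : S)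
    (K : Set (Fin n → ℂ)) (ε C : ℝ) : Prop :=
  ∀ γ, ∀ z ∈ K, ∀ w : Fin k → ℂ,
    ‖F.bCoeff η s γ (z, w)‖ ≤ C / (1 + ∑ δ, ‖w δ‖ ^ (1 + ε)) ∧
    ∀ v ∈ realCoordDirs n k,
      ‖fderiv ℝ (F.bCoeff η s γ) (z, w) v‖ ≤ C / (1 + ∑ δ, ‖w δ‖ ^ (1 + ε))

/-- The form `η` is decreasing along the fibers. -/
def IsDecreasing (F : HolomorphicFiberBundle n k X S) (η : ZeroOneForm n k X) : Prop :=
  ∀ s, ∀ K ⊆ F.U s, IsCompact K →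
    (∀ α, ∀ θ > (0 : ℝ), ∃ M > (0 : ℝ), ∀ w : Fin k → ℂ, M ≤ euclLength w →
      ∀ z ∈ K, ‖F.aCoeff η s α (z, w)‖ < θ) ∧
    ∃ ε > (0 : ℝ), ∃ C : ℝ, F.BDecay η s K ε C

end HolomorphicFiberBundle

/-- `∫_ℂ h(ζ) dζ ∧ dζ̄`, where `dζ ∧ dζ̄ = -2i dξ ∧ dη` for `ζ = ξ + iη`. -/
def wedgeIntegral (h : ℂ → ℂ) : ℂ := -2 * Complex.I * ∫ ζ : ℂ, h ζ

/-- `∫_ℂ h(ζ) |dζ ∧ dζ̄|`, where `|dζ ∧ dζ̄| = 2 dξ dη`. -/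
def absWedgeIntegral (h : ℂ → ℝ) : ℝ := 2 * ∫ ζ : ℂ, h ζ

/-- The integrand `b(z, w_1, …, ζ, …, w_k) / (ζ - w_δ)` (`ζ` in position `δ`) of the Cauchy
transform. -/
def cauchyIntegrand {n k : ℕ} (δ : Fin k) (b : ZW n k → ℂ) (p : ZW n k) (ζ : ℂ) : ℂ :=
  b (p.1, Function.update p.2 δ ζ) / (ζ - p.2 δ)

/-- The function `|ζ|⁻¹ (1 + ∑_{γ ≠ δ} |w_γ|^{1+ε} + |w_δ + ζ|^{1+ε})⁻¹`. -/
def boundIntegrand {k : ℕ} (δ : Fin k) (ε : ℝ) (w : Fin k → ℂ) (ζ : ℂ) : ℝ :=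
  1 / ‖ζ‖ *
    (1 / (1 + ∑ γ ∈ Finset.univ.erase δ, ‖w γ‖ ^ (1 + ε) + ‖w δ + ζ‖ ^ (1 + ε)))

end

/-!
For a function `b` on `U × ℂᵏ` that decays along the fibres together with its first derivatives, the
Cauchy transform in the variable `w_δ` is, after a translation, `-π⁻¹ ∫ b(p + ζ e_δ) / ζ dA(ζ)`. The
integrand and its derivatives in `p` are dominated, locally uniformly in `p`, by multiples of
`|ζ|⁻¹ (1 + |w_δ + ζ|^{1+ε})⁻¹`. This kernel is integrable, with an integral bounded in `w_δ` and
tending to zero as `|w_δ| → ∞`; hence the Cauchy transform is `C¹`, bounded, and small for large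
`|w_δ|` (`LocallyFiberDecay.contDiffOn`, `FiberDecay.norm_cauchyTransform_le`,
`FiberDecay.exists_bound`, `FiberDecay.exists_forall_lt`).

In a chart let `B_δ` be the Cauchy transform of the coefficient `b_δ`. A derivative `∂/∂z̄_α` or
`∂/∂w̄_γ` passes under the integral sign, and since the form is closed it turns `b_δ` into
`∂a_α/∂w̄_δ` or `∂b_γ/∂w̄_δ`. The Cauchy–Pompeiu formula in the whole plane
(`integral_dbarC_div_eq`), applicable because the coefficients vanish at infinity, evaluates the
resulting integral to `a_α` or `b_γ`. So every `B_δ` solves the equation in its chart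
(`HolomorphicFiberBundle.antilinearPart_fderiv_localSolution`).

Two such solutions, for different `δ` or different charts, differ on a fibre `ℂᵏ` by a bounded
entire function, which is constant by Liouville's theorem
(`HolomorphicFiberBundle.localSolution_sub_eq`). Within a chart the constant is zero because `B_δ`
and `B_γ` both vanish at infinity along the diagonal of `ℂᵏ`. Knowing this, `B_δ` is small as soon as
any coordinate of `w` is large, so it vanishes at infinity on `ℂᵏ`; and since a biholomorphism of
`ℂᵏ` is proper, the constant is zero for two different charts too. Hence the local solutions glue to
a global one, and all the assertions can be read off in the charts.
-/

noncomputable section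

open MeasureTheory Filter Topology

/-! ### The kernel `|ζ|⁻¹ (1 + |w + ζ|^{1+ε})⁻¹` -/

/-- The kernel `|ζ|⁻¹ (1 + |ξ|^{1+ε})⁻¹`, used with `ξ = w + ζ`; its value at `ζ = 0` is `0`. -/
def cauchyKernel (ε : ℝ) (ζ ξ : ℂ) : ℝ := 1 / ‖ζ‖ * (1 / (1 + ‖ξ‖ ^ (1 + ε)))

lemma cauchyKernel_nonneg (ε : ℝ) (ζ ξ : ℂ) : 0 ≤ cauchyKernel ε ζ ξ := by
  unfold cauchyKernel; positivity

lemma measurable_cauchyKernel (ε : ℝ) (w : ℂ) : Measurable fun ζ => cauchyKernel ε ζ (w + ζ) := by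
  unfold cauchyKernel
  fun_prop

lemma integrable_cauchyKernel_diag {ε : ℝ} (hε : 0 < ε) :
    Integrable fun ζ : ℂ => cauchyKernel ε ζ ζ := by
  have h1 : IntegrableOn (fun y : ℝ => 1 / (1 + y ^ (1 + ε))) (Set.Ioi 0) := by
    have hm : Measurable fun y : ℝ => 1 / (1 + y ^ (1 + ε)) := by fun_prop
    rw [← Set.Ioc_union_Ioi_eq_Ioi zero_le_one]
    refine IntegrableOn.union ?_ ?_
    · refine Measure.integrableOn_of_bounded (M := 1) (by simp) hm.aestronglyMeasurable ?_
      filter_upwards [ae_restrict_mem measurableSet_Ioc] with y hy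
      have : 0 ≤ y ^ (1 + ε) := Real.rpow_nonneg hy.1.le _
      rw [Real.norm_of_nonneg (by positivity)]
      exact div_le_one_of_le₀ (by linarith) (by positivity)
    · refine (integrableOn_Ioi_rpow_of_lt (a := -(1 + ε)) (by linarith) one_pos).mono'
        hm.aestronglyMeasurable ?_
      filter_upwards [ae_restrict_mem measurableSet_Ioi] with y hy
      have hy0 : 0 < y := one_pos.trans hy
      have : 0 < y ^ (1 + ε) := Real.rpow_pos_of_pos hy0 _
      rw [Real.norm_of_nonneg (by positivity), Real.rpow_neg hy0.le, ← one_div]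
      gcongr
      linarith
  refine (integrable_fun_norm_addHaar (E := ℂ) volume
    (f := fun y : ℝ => 1 / y * (1 / (1 + y ^ (1 + ε))))).2 ?_
  refine h1.congr_fun (fun y hy => ?_) measurableSet_Ioi
  have hy0 : y ≠ 0 := (Set.mem_Ioi.1 hy).ne'
  simp only [Complex.finrank_real_complex, smul_eq_mul]
  norm_num
  field_simp

lemma cauchyKernel_le_left {ε : ℝ} (hε : 0 < ε) {ζ ξ : ℂ} (h : ‖ζ‖ ≤ ‖ξ‖) :
    cauchyKernel ε ζ ξ ≤ cauchyKernel ε ζ ζ := by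
  unfold cauchyKernel
  gcongr

lemma cauchyKernel_le_right {ε : ℝ} {ζ ξ : ℂ} (hξ : ξ ≠ 0) (h : ‖ξ‖ ≤ ‖ζ‖) :
    cauchyKernel ε ζ ξ ≤ cauchyKernel ε ξ ξ := by
  have : 0 < ‖ξ‖ := norm_pos_iff.2 hξ
  unfold cauchyKernel
  gcongr

/-- The estimate can fail at `ζ = -w`, where the second term on the right is `0`. -/
lemma ae_cauchyKernel_le {ε : ℝ} (hε : 0 < ε) (w : ℂ) :
    ∀ᵐ ζ : ℂ, cauchyKernel ε ζ (w + ζ) ≤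
      cauchyKernel ε ζ ζ + cauchyKernel ε (w + ζ) (w + ζ) := by
  have hne : ∀ᵐ ζ : ℂ, ζ ≠ -w := by simp [ae_iff]
  filter_upwards [hne] with ζ hζ
  have hne : w + ζ ≠ 0 := fun h => hζ (eq_neg_of_add_eq_zero_right h)
  have h1 := cauchyKernel_nonneg ε ζ ζ
  have h2 := cauchyKernel_nonneg ε (w + ζ) (w + ζ)
  rcases le_total ‖ζ‖ ‖w + ζ‖ with h | h
  · linarith [cauchyKernel_le_left hε h]
  · linarith [cauchyKernel_le_right (ε := ε) hne h]

lemma integrable_cauchyKernel {ε : ℝ} (hε : 0 < ε) (w : ℂ) :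
    Integrable fun ζ => cauchyKernel ε ζ (w + ζ) := by
  have h1 := integrable_cauchyKernel_diag hε
  refine (h1.add (h1.comp_add_left w)).mono' (measurable_cauchyKernel ε w).aestronglyMeasurable ?_
  filter_upwards [ae_cauchyKernel_le hε w] with ζ hζ
  rwa [Real.norm_of_nonneg (cauchyKernel_nonneg _ _ _)]

lemma integral_cauchyKernel_le {ε : ℝ} (hε : 0 < ε) (w : ℂ) :
    ∫ ζ, cauchyKernel ε ζ (w + ζ) ≤ 2 * ∫ ζ, cauchyKernel ε ζ ζ := by
  have h1 := integrable_cauchyKernel_diag hε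
  calc ∫ ζ, cauchyKernel ε ζ (w + ζ)
      ≤ ∫ ζ, (cauchyKernel ε ζ ζ + cauchyKernel ε (w + ζ) (w + ζ)) :=
        integral_mono_ae (integrable_cauchyKernel hε w) (h1.add (h1.comp_add_left w))
          (ae_cauchyKernel_le hε w)
    _ = 2 * ∫ ζ, cauchyKernel ε ζ ζ := by
        rw [integral_add h1 (h1.comp_add_left w),
          integral_add_left_eq_self (fun ζ => cauchyKernel ε ζ ζ) w]
        ring

instance : (Bornology.cobounded ℂ).IsCountablyGenerated := by
  rw [← comap_norm_atTop]; infer_instance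

/-- On `|ζ| ≤ |w + ζ|` the kernel is dominated by its diagonal value at `ζ`, on the complement, after
the translation `ξ = w + ζ`, by that at `ξ`; dominated convergence applies to both parts. -/
lemma tendsto_integral_cauchyKernel {ε : ℝ} (hε : 0 < ε) :
    Tendsto (fun w : ℂ => ∫ ζ, cauchyKernel ε ζ (w + ζ)) (Bornology.cobounded ℂ) (𝓝 0) := by
  have hdiag := integrable_cauchyKernel_diag hε
  have hKζ : ∀ ζ : ℂ, Tendsto (fun w => cauchyKernel ε ζ (w + ζ)) (Bornology.cobounded ℂ) (𝓝 0) := by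
    intro ζ
    have h1 : Tendsto (fun w : ℂ => 1 + ‖w + ζ‖ ^ (1 + ε)) (Bornology.cobounded ℂ) atTop :=
      tendsto_atTop_add_const_left _ _ ((tendsto_rpow_atTop (by linarith)).comp
        (tendsto_norm_cobounded_atTop.comp (tendsto_add_const_cobounded ζ)))
    simpa [cauchyKernel] using h1.inv_tendsto_atTop.const_mul (1 / ‖ζ‖)
  have hKξ : ∀ ξ : ℂ, Tendsto (fun w => cauchyKernel ε (ξ - w) ξ) (Bornology.cobounded ℂ) (𝓝 0) := by
    intro ξ
    have h1 : Tendsto (fun w : ℂ => ‖ξ - w‖) (Bornology.cobounded ℂ) atTop :=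
      tendsto_norm_cobounded_atTop.comp (tendsto_const_sub_cobounded ξ)
    simpa [cauchyKernel] using h1.inv_tendsto_atTop.mul_const (1 / (1 + ‖ξ‖ ^ (1 + ε)))
  have hmξ : ∀ w : ℂ, Measurable fun ξ => cauchyKernel ε (ξ - w) ξ := by
    intro w; unfold cauchyKernel; fun_prop
  -- the two parts, the second one already translated
  let P : ℂ → ℂ → ℝ := fun w ζ => if ‖ζ‖ ≤ ‖w + ζ‖ then cauchyKernel ε ζ (w + ζ) else 0
  let Q : ℂ → ℂ → ℝ := fun w ξ => if ‖ξ‖ ≤ ‖ξ - w‖ then cauchyKernel ε (ξ - w) ξ else 0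
  have hP0 : ∀ w ζ, 0 ≤ P w ζ := fun w ζ => by
    simp only [P]; split_ifs; exacts [cauchyKernel_nonneg _ _ _, le_rfl]
  have hQ0 : ∀ w ζ, 0 ≤ Q w ζ := fun w ζ => by
    simp only [Q]; split_ifs; exacts [cauchyKernel_nonneg _ _ _, le_rfl]
  have hPm : ∀ w, Measurable (P w) := fun w =>
    Measurable.ite (measurableSet_le (by fun_prop) (by fun_prop)) (measurable_cauchyKernel ε w)
      measurable_const
  have hQm : ∀ w, Measurable (Q w) := fun w =>
    Measurable.ite (measurableSet_le (by fun_prop) (by fun_prop)) (hmξ w) measurable_const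
  have hPle : ∀ w, ∀ᵐ ζ, ‖P w ζ‖ ≤ cauchyKernel ε ζ ζ := fun w => by
    refine Eventually.of_forall fun ζ => ?_
    rw [Real.norm_of_nonneg (hP0 _ _)]
    simp only [P]; split_ifs with h
    exacts [cauchyKernel_le_left hε h, cauchyKernel_nonneg _ _ _]
  have hQle : ∀ w, ∀ᵐ ξ, ‖Q w ξ‖ ≤ cauchyKernel ε ξ ξ := fun w => by
    have hne : ∀ᵐ ξ : ℂ, ξ ≠ 0 := by simp [ae_iff]
    filter_upwards [hne] with ξ hξ
    rw [Real.norm_of_nonneg (hQ0 _ _)]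
    simp only [Q]; split_ifs with h
    exacts [cauchyKernel_le_right hξ h, cauchyKernel_nonneg _ _ _]
  have hPt : Tendsto (fun w => ∫ ζ, P w ζ) (Bornology.cobounded ℂ) (𝓝 (∫ _ : ℂ, (0 : ℝ))) := by
    refine tendsto_integral_filter_of_dominated_convergence _
      (Eventually.of_forall fun w => (hPm w).aestronglyMeasurable) (Eventually.of_forall hPle) hdiag
      (Eventually.of_forall fun ζ => squeeze_zero (fun w => hP0 w ζ) (fun w => ?_) (hKζ ζ))
    simp only [P]; split_ifs
    exacts [le_rfl, cauchyKernel_nonneg _ _ _]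
  have hQt : Tendsto (fun w => ∫ ζ, Q w ζ) (Bornology.cobounded ℂ) (𝓝 (∫ _ : ℂ, (0 : ℝ))) := by
    refine tendsto_integral_filter_of_dominated_convergence _
      (Eventually.of_forall fun w => (hQm w).aestronglyMeasurable) (Eventually.of_forall hQle) hdiag
      (Eventually.of_forall fun ξ => squeeze_zero (fun w => hQ0 w ξ) (fun w => ?_) (hKξ ξ))
    simp only [Q]; split_ifs
    exacts [le_rfl, cauchyKernel_nonneg _ _ _]
  have hsum := hPt.add hQt
  simp only [integral_zero, add_zero] at hsum
  refine squeeze_zero (fun w => integral_nonneg fun ζ => cauchyKernel_nonneg _ _ _)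
    (fun w => ?_) hsum
  have hPi : Integrable (P w) := hdiag.mono' (hPm w).aestronglyMeasurable (hPle w)
  have hQi : Integrable (Q w) := hdiag.mono' (hQm w).aestronglyMeasurable (hQle w)
  rw [← integral_add_left_eq_self (Q w) w, ← integral_add hPi (hQi.comp_add_left w)]
  refine integral_mono (integrable_cauchyKernel hε w) (hPi.add (hQi.comp_add_left w)) fun ζ => ?_
  have hP := hP0 w ζ
  have hQ := hQ0 w (w + ζ)
  rcases le_total ‖ζ‖ ‖w + ζ‖ with h | h
  · have : P w ζ = cauchyKernel ε ζ (w + ζ) := if_pos h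
    linarith
  · have : Q w (w + ζ) = cauchyKernel ε ζ (w + ζ) := by
      simp only [Q, add_sub_cancel_left]; exact if_pos h
    linarith

/-! ### The Cauchy–Pompeiu formula in the whole plane -/

/-- The Wirtinger derivative `∂f/∂ζ̄ = (∂f/∂ξ + i ∂f/∂η)/2` of a function on `ℂ`. -/
def dbarC (f : ℂ → ℂ) (ζ : ℂ) : ℂ :=
  (1 / 2 : ℂ) * (fderiv ℝ f ζ 1 + Complex.I * fderiv ℝ f ζ Complex.I)

lemma continuous_dbarC {f : ℂ → ℂ} (hf : ContDiff ℝ 1 f) : Continuous (dbarC f) := by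
  have h := hf.continuous_fderiv one_ne_zero
  unfold dbarC
  fun_prop

/-- In polar coordinates, `ρ (∂f/∂ζ̄) / ζ = (∂_ρ f + (i/ρ) ∂_θ f) / 2`. The second term has integral
zero over every circle, so the integral over the circle of radius `ρ` is the derivative of half the
circular integral of `f`, and the fundamental theorem of calculus on `(0, ∞)` applies. -/
theorem integral_dbarC_div_eq {f : ℂ → ℂ} (hf : ContDiff ℝ 1 f)
    (h0 : Tendsto f (Bornology.cobounded ℂ) (𝓝 0))
    (hint : Integrable fun ζ => dbarC f ζ / ζ) :
    ∫ ζ, dbarC f ζ / ζ = -Real.pi * f 0 := by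
  let e : ℝ → ℂ := fun θ => Complex.exp (θ * Complex.I)
  have he : ContDiff ℝ 1 e := by
    exact (Complex.ofRealCLM.contDiff.mul contDiff_const).cexp
  have hed : ∀ θ, HasDerivAt e (Complex.I * e θ) θ := by
    intro θ
    have h := ((Complex.ofRealCLM.hasDerivAt (x := θ)).mul_const Complex.I).cexp
    simp at h
    simpa [e, mul_comm] using h
  have hen : ∀ θ, ‖e θ‖ = 1 := fun θ => Complex.norm_exp_ofReal_mul_I θ
  have hpolar : ∀ p : ℝ × ℝ, Complex.polarCoord.symm p = p.1 * e p.2 := fun p => by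
    simp [e, Complex.exp_mul_I]
  let D : ℝ → ℝ → ℂ := fun r θ => fderiv ℝ f (r * e θ) (e θ)
  have hDcont : Continuous (Function.uncurry D) := by
    have h := hf.continuous_fderiv one_ne_zero
    have he' := he.continuous
    simp only [D, Function.uncurry_def]
    fun_prop
  let H : ℝ × ℝ → ℂ := fun p => dbarC f (p.1 * e p.2) / e p.2
  have hHcont : Continuous H := by
    have h := continuous_dbarC hf
    have he' := he.continuous
    refine Continuous.div (by fun_prop) (by fun_prop) fun p => ?_
    exact Complex.exp_ne_zero _
  have hHeq : ∀ p ∈ polarCoord.target, p.1 • (dbarC f (Complex.polarCoord.symm p) /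
      Complex.polarCoord.symm p) = H p := by
    intro p hp
    have hr : (p.1 : ℂ) ≠ 0 := Complex.ofReal_ne_zero.2 (ne_of_gt hp.1)
    have : e p.2 ≠ 0 := Complex.exp_ne_zero _
    rw [hpolar, Complex.real_smul]
    simp only [H]
    field_simp
  -- the polar form of the integrand is integrable
  have hHint : IntegrableOn H (Set.Ioi (0 : ℝ) ×ˢ Set.Ioo (-Real.pi) Real.pi) := by
    refine ⟨hHcont.aestronglyMeasurable, ?_⟩
    -- the change of variables for lower integrals needs no integrability
    have h1 := Complex.lintegral_comp_polarCoord_symm fun ζ => ‖dbarC f ζ / ζ‖ₑ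
    have h2 := hint.2
    rw [HasFiniteIntegral, ← h1] at h2
    refine lt_of_eq_of_lt ?_ h2
    refine setLIntegral_congr_fun (measurableSet_Ioi.prod measurableSet_Ioo) fun p hp => ?_
    rw [← hHeq p hp, enorm_smul, Real.enorm_of_nonneg (le_of_lt hp.1), smul_eq_mul]
  let m : ℝ → ℂ := fun r => ∫ θ in -Real.pi..Real.pi, f (r * e θ)
  have hmd : ∀ r : ℝ, HasDerivAt m (∫ θ in -Real.pi..Real.pi, D r θ) r := by
    intro r
    obtain ⟨M, hM⟩ := ((isCompact_closedBall r 1).prod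
      (isCompact_Icc (a := -Real.pi) (b := Real.pi))).exists_bound_of_continuousOn
        hDcont.continuousOn
    have hpi : -Real.pi ≤ Real.pi := by linarith [Real.pi_pos]
    have hfc := hf.continuous
    have hec := he.continuous
    refine (intervalIntegral.hasDerivAt_integral_of_dominated_loc_of_deriv_le
      (F' := D) (bound := fun _ => M) (Metric.closedBall_mem_nhds r one_pos) ?_ ?_ ?_ ?_ ?_ ?_).2
    · exact Eventually.of_forall fun x => (by fun_prop : Continuous _).aestronglyMeasurable
    · exact (by fun_prop : Continuous _).intervalIntegrable _ _
    · exact (hDcont.comp (by fun_prop : Continuous fun θ : ℝ => (r, θ))).aestronglyMeasurable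
    · refine Eventually.of_forall fun θ hθ x hx => hM (x, θ) ⟨hx, ?_⟩
      rw [Set.uIoc_of_le hpi] at hθ
      exact ⟨hθ.1.le, hθ.2⟩
    · exact intervalIntegrable_const
    · refine Eventually.of_forall fun θ _ x _ => ?_
      have h1 : HasDerivAt (fun x : ℝ => (x : ℂ) * e θ) (e θ) x := by
        simpa using (Complex.ofRealCLM.hasDerivAt (x := x)).mul_const (e θ)
      exact ((hf.differentiable one_ne_zero _).hasFDerivAt).comp_hasDerivAt x h1
  -- the angular derivative integrates to zero
  have hang : ∀ r : ℝ, ∫ θ in -Real.pi..Real.pi,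
      fderiv ℝ f (r * e θ) (r * (Complex.I * e θ)) = 0 := by
    intro r
    have hfd := hf.continuous_fderiv one_ne_zero
    have hec := he.continuous
    rw [intervalIntegral.integral_eq_sub_of_hasDerivAt (f := fun θ => f (r * e θ))
      (fun θ _ => ((hf.differentiable one_ne_zero _).hasFDerivAt).comp_hasDerivAt θ
        ((hed θ).const_mul (r : ℂ)))
      ((by fun_prop : Continuous _).intervalIntegrable _ _)]
    have : e Real.pi = e (-Real.pi) := by
      simp [e, Complex.exp_neg, Complex.exp_pi_mul_I]
    simp [this]
  have hH : ∀ r ∈ Set.Ioi (0 : ℝ), ∫ θ in Set.Ioo (-Real.pi) Real.pi, H (r, θ) =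
      (1 / 2 : ℂ) * ∫ θ in -Real.pi..Real.pi, D r θ := by
    intro r hr
    have hr0 : (r : ℂ) ≠ 0 := Complex.ofReal_ne_zero.2 (ne_of_gt hr)
    have hpt : ∀ θ, H (r, θ) = (1 / 2 : ℂ) * D r θ +
        (Complex.I / (2 * r)) * fderiv ℝ f (r * e θ) (r * (Complex.I * e θ)) := by
      intro θ
      simp only [H, D, dbarC]
      set L := fderiv ℝ f (r * e θ)
      have hL : ∀ z : ℂ, L z = z.re * L 1 + z.im * L Complex.I := by
        intro z
        have hz : z = z.re • (1 : ℂ) + z.im • Complex.I := by simp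
        conv_lhs => rw [hz]
        rw [map_add, map_smul, map_smul, Complex.real_smul, Complex.real_smul]
      have hre : (e θ).re = Real.cos θ := Complex.exp_ofReal_mul_I_re θ
      have him : (e θ).im = Real.sin θ := Complex.exp_ofReal_mul_I_im θ
      have heθ : e θ = Real.cos θ + Real.sin θ * Complex.I := by
        simp [e, Complex.exp_mul_I]
      have hmul : (r : ℂ) * (Complex.I * e θ) = r • (Complex.I * e θ) := by simp
      have hinv : (e θ)⁻¹ = Real.cos θ - Real.sin θ * Complex.I := by
        refine inv_eq_of_mul_eq_one_right ?_
        rw [heθ]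
        have h := Complex.cos_sq_add_sin_sq θ
        push_cast
        linear_combination h - Complex.sin θ ^ 2 * Complex.I_sq
      rw [hmul, map_smul, hL (e θ), hL (Complex.I * e θ), div_eq_mul_inv _ (e θ), hinv]
      simp only [Complex.mul_re, Complex.mul_im, hre, him, Complex.I_re, Complex.I_im,
        Complex.real_smul]
      push_cast
      field_simp
      linear_combination (-Complex.sin θ * L Complex.I) * Complex.I_sq
    rw [← integral_Ioc_eq_integral_Ioo, ← intervalIntegral.integral_of_le
      (by linarith [Real.pi_pos]), intervalIntegral.integral_congr (fun θ _ => hpt θ),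
      intervalIntegral.integral_add, intervalIntegral.integral_const_mul,
      intervalIntegral.integral_const_mul, hang, mul_zero, add_zero]
    · exact ((hDcont.comp (by fun_prop : Continuous fun θ : ℝ => (r, θ))).const_mul
        _).intervalIntegrable _ _
    · have hfd := hf.continuous_fderiv one_ne_zero
      have hec := he.continuous
      exact (by fun_prop : Continuous _).intervalIntegrable _ _
  have hm_top : Tendsto m atTop (𝓝 0) := by
    rw [Metric.tendsto_atTop]
    intro ε hε
    have h2 : ∀ᶠ ζ in Bornology.cobounded ℂ, ‖f ζ‖ < ε / (4 * Real.pi) :=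
      (tendsto_zero_iff_norm_tendsto_zero.1 h0).eventually_lt_const (by positivity)
    obtain ⟨R, -, hR⟩ := (hasBasis_cobounded_norm (E := ℂ)).eventually_iff.1 h2
    refine ⟨max R 0, fun r hr => ?_⟩
    have hr0 : 0 ≤ r := (le_max_right _ _).trans hr
    rw [dist_zero_right]
    have h3 : ‖m r‖ ≤ ε / (4 * Real.pi) * |Real.pi - -Real.pi| := by
      refine intervalIntegral.norm_integral_le_of_norm_le_const fun θ _ => (hR ?_).le
      simp only [Set.mem_ofPred_eq, norm_mul, hen, Complex.norm_real, Real.norm_eq_abs,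
        abs_of_nonneg hr0, mul_one]
      exact (le_max_left _ _).trans hr
    have h4 : |Real.pi - -Real.pi| = 2 * Real.pi := by
      rw [abs_of_pos] <;> linarith [Real.pi_pos]
    rw [h4] at h3
    have : ε / (4 * Real.pi) * (2 * Real.pi) = ε / 2 := by
      have := Real.pi_pos.ne'
      field_simp; norm_num
    linarith
  have hDint : IntegrableOn (fun r => ∫ θ in -Real.pi..Real.pi, D r θ) (Set.Ioi 0) := by
    have h1 : IntegrableOn (fun r => ∫ θ in Set.Ioo (-Real.pi) Real.pi, H (r, θ)) (Set.Ioi 0) := by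
      rw [IntegrableOn, Measure.volume_eq_prod, ← Measure.prod_restrict] at hHint
      exact hHint.integral_prod_left
    have h2 : IntegrableOn (fun r => (2 : ℂ) * ∫ θ in Set.Ioo (-Real.pi) Real.pi, H (r, θ))
      (Set.Ioi 0) := h1.const_mul 2
    refine h2.congr_fun (fun r hr => ?_) measurableSet_Ioi
    simp only
    rw [hH r hr]
    ring
  rw [← Complex.integral_comp_polarCoord_symm,
    setIntegral_congr_fun polarCoord.open_target.measurableSet hHeq]
  change ∫ p in Set.Ioi (0 : ℝ) ×ˢ Set.Ioo (-Real.pi) Real.pi, H p = _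
  rw [Measure.volume_eq_prod] at hHint ⊢
  rw [setIntegral_prod _ hHint, setIntegral_congr_fun measurableSet_Ioi hH, integral_const_mul,
    integral_Ioi_of_hasDerivAt_of_tendsto (hmd 0).continuousAt.continuousWithinAt
      (fun r _ => hmd r) hDint hm_top]
  have : m 0 = 2 * Real.pi * f 0 := by
    simp only [m, Complex.ofReal_zero, zero_mul, intervalIntegral.integral_const, Complex.real_smul]
    push_cast
    ring
  rw [this]
  ring

/-! ### The Cauchy transform along a fibre coordinate -/

variable {n k : ℕ}

/-- The Cauchy transform of `b` in the variable `w_δ`. -/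
def cauchyTransform (δ : Fin k) (b : ZW n k → ℂ) (p : ZW n k) : ℂ :=
  1 / (2 * Real.pi * Complex.I) * wedgeIntegral (cauchyIntegrand δ b p)

/-- The function `b` and its first-order real partial derivatives are bounded by
`C / (1 + |w_1|^{1+ε} + ⋯ + |w_k|^{1+ε})` over `K`. -/
def FiberDecay (b : ZW n k → ℂ) (K : Set (Fin n → ℂ)) (ε C : ℝ) : Prop :=
  ∀ z ∈ K, ∀ w : Fin k → ℂ,
    ‖b (z, w)‖ ≤ C / (1 + ∑ δ, ‖w δ‖ ^ (1 + ε)) ∧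
    ∀ v ∈ realCoordDirs n k,
      ‖fderiv ℝ b (z, w) v‖ ≤ C / (1 + ∑ δ, ‖w δ‖ ^ (1 + ε))

/-- `c ↦ wDir δ c` as a continuous real-linear map. -/
def wDirL (δ : Fin k) : ℂ →L[ℝ] ZW n k :=
  (ContinuousLinearMap.inr ℝ (Fin n → ℂ) (Fin k → ℂ)).comp
    (ContinuousLinearMap.single ℝ (fun _ : Fin k => ℂ) δ)

lemma wDirL_apply (δ : Fin k) (c : ℂ) : wDirL (n := n) δ c = wDir δ c := rfl

@[fun_prop]
lemma continuous_wDir (δ : Fin k) : Continuous (wDir (n := n) δ) := (wDirL δ).continuous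

lemma antilinearPart_apply (L : ZW n k →L[ℝ] ℂ) (v : ZW n k) :
    antilinearPart L v = (1 / 2 : ℂ) * (L v + Complex.I * L (Complex.I • v)) := rfl

lemma add_wDir_apply_same (δ : Fin k) (p : ZW n k) (ζ : ℂ) :
    (p + wDir δ ζ).2 δ = p.2 δ + ζ := by
  simp [wDir]

lemma add_wDir_apply_ne {δ γ : Fin k} (h : γ ≠ δ) (p : ZW n k) (ζ : ℂ) :
    (p + wDir δ ζ).2 γ = p.2 γ := by
  simp [wDir, h]

lemma add_wDir_fst (δ : Fin k) (p : ZW n k) (ζ : ℂ) : (p + wDir δ ζ).1 = p.1 := by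
  simp [wDir]

lemma cauchyIntegrand_add (δ : Fin k) (b : ZW n k → ℂ) (p : ZW n k) (ζ : ℂ) :
    cauchyIntegrand δ b p (p.2 δ + ζ) = b (p + wDir δ ζ) / ζ := by
  have : (p.1, Function.update p.2 δ (p.2 δ + ζ)) = p + wDir δ ζ := by
    refine Prod.ext (add_wDir_fst δ p ζ).symm (funext fun γ => ?_)
    rcases eq_or_ne γ δ with rfl | h
    · rw [add_wDir_apply_same]; simp
    · rw [add_wDir_apply_ne h]; simp [h]
  simp [cauchyIntegrand, this]

lemma cauchyTransform_eq (δ : Fin k) (b : ZW n k → ℂ) (p : ZW n k) :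
    cauchyTransform δ b p = -(1 / Real.pi : ℂ) * ∫ ζ, b (p + wDir δ ζ) / ζ := by
  have hpi : (Real.pi : ℂ) ≠ 0 := Complex.ofReal_ne_zero.2 Real.pi_ne_zero
  rw [cauchyTransform, wedgeIntegral, ← integral_add_left_eq_self _ (p.2 δ)]
  simp only [cauchyIntegrand_add]
  field_simp [Complex.I_ne_zero]

lemma integrable_cauchyIntegrand_iff (δ : Fin k) (b : ZW n k → ℂ) (p : ZW n k) :
    Integrable (cauchyIntegrand δ b p) ↔ Integrable fun ζ => b (p + wDir δ ζ) / ζ := by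
  simp only [← cauchyIntegrand_add]
  refine ⟨fun h => h.comp_add_left _, fun h => ?_⟩
  simpa using h.comp_add_left (-p.2 δ)

/-! ### The decay estimates -/

lemma decay_add_wDir (δ : Fin k) (ε : ℝ) (p : ZW n k) (ζ : ℂ) :
    ∑ γ, ‖(p + wDir δ ζ).2 γ‖ ^ (1 + ε) =
      ∑ γ ∈ Finset.univ.erase δ, ‖p.2 γ‖ ^ (1 + ε) + ‖p.2 δ + ζ‖ ^ (1 + ε) := by
  rw [← Finset.sum_erase_add _ _ (Finset.mem_univ δ), add_wDir_apply_same]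
  congr 1
  exact Finset.sum_congr rfl fun γ hγ => by rw [add_wDir_apply_ne (Finset.ne_of_mem_erase hγ)]

lemma boundIntegrand_nonneg (δ : Fin k) (ε : ℝ) (w : Fin k → ℂ) (ζ : ℂ) :
    0 ≤ boundIntegrand δ ε w ζ := by
  unfold boundIntegrand; positivity

lemma boundIntegrand_le (δ : Fin k) (ε : ℝ) (w : Fin k → ℂ) (ζ : ℂ) :
    boundIntegrand δ ε w ζ ≤ cauchyKernel ε ζ (w δ + ζ) := by
  unfold boundIntegrand cauchyKernel
  have : 0 ≤ ∑ γ ∈ Finset.univ.erase δ, ‖w γ‖ ^ (1 + ε) := by positivity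
  gcongr
  linarith

lemma integrable_boundIntegrand (δ : Fin k) {ε : ℝ} (hε : 0 < ε) (w : Fin k → ℂ) :
    Integrable (boundIntegrand δ ε w) := by
  refine (integrable_cauchyKernel hε (w δ)).mono' ?_ (Eventually.of_forall fun ζ => ?_)
  · have : Measurable (boundIntegrand δ ε w) := by unfold boundIntegrand; fun_prop
    exact this.aestronglyMeasurable
  · rw [Real.norm_of_nonneg (boundIntegrand_nonneg _ _ _ _)]
    exact boundIntegrand_le _ _ _ _

lemma FiberDecay.norm_div_le {b : ZW n k → ℂ} {K : Set (Fin n → ℂ)} {ε C : ℝ}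
    (h : FiberDecay b K ε C) (δ : Fin k) {p : ZW n k} (hp : p.1 ∈ K) (ζ : ℂ) :
    ‖b (p + wDir δ ζ) / ζ‖ ≤ C * boundIntegrand δ ε p.2 ζ := by
  have h1 := (h (p + wDir δ ζ).1 (by rwa [add_wDir_fst]) (p + wDir δ ζ).2).1
  rw [decay_add_wDir, ← add_assoc] at h1
  rw [norm_div]
  calc _ ≤ _ / ‖ζ‖ := div_le_div_of_nonneg_right h1 (norm_nonneg _)
    _ = _ := by rw [boundIntegrand]; ring

lemma continuous_comp_add_wDir {U : Set (Fin n → ℂ)} {E : Type*} [TopologicalSpace E]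
    {b : ZW n k → E} (hb : ContinuousOn b (U ×ˢ Set.univ)) (δ : Fin k) {p : ZW n k}
    (hp : p.1 ∈ U) : Continuous fun ζ => b (p + wDir δ ζ) :=
  hb.comp_continuous (by fun_prop) fun ζ => ⟨by rwa [add_wDir_fst], trivial⟩

lemma FiberDecay.integrable {U K : Set (Fin n → ℂ)} {b : ZW n k → ℂ} {ε C : ℝ}
    (h : FiberDecay b K ε C) (hε : 0 < ε) (hb : ContinuousOn b (U ×ˢ Set.univ)) (hKU : K ⊆ U)
    (δ : Fin k) {p : ZW n k} (hp : p.1 ∈ K) : Integrable fun ζ => b (p + wDir δ ζ) / ζ := by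
  refine ((integrable_boundIntegrand δ hε p.2).const_mul C).mono' ?_
    (Eventually.of_forall (h.norm_div_le δ hp))
  exact ((continuous_comp_add_wDir hb δ (hKU hp)).measurable.div
    measurable_id).aestronglyMeasurable

lemma FiberDecay.norm_cauchyTransform_le {K : Set (Fin n → ℂ)} {b : ZW n k → ℂ} {ε C : ℝ}
    (h : FiberDecay b K ε C) (hε : 0 < ε) (δ : Fin k) {p : ZW n k} (hp : p.1 ∈ K) :
    ‖cauchyTransform δ b p‖ ≤ C / (2 * Real.pi) * absWedgeIntegral (boundIntegrand δ ε p.2) := by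
  have hpi := Real.pi_pos
  have h1 : ‖∫ ζ, b (p + wDir δ ζ) / ζ‖ ≤ ∫ ζ, C * boundIntegrand δ ε p.2 ζ :=
    norm_integral_le_of_norm_le ((integrable_boundIntegrand δ hε p.2).const_mul C)
      (Eventually.of_forall (h.norm_div_le δ hp))
  rw [integral_const_mul] at h1
  have h2 : ‖-(1 / Real.pi : ℂ)‖ = 1 / Real.pi := by
    rw [norm_neg, norm_div, norm_one, Complex.norm_real, Real.norm_of_nonneg hpi.le]
  rw [cauchyTransform_eq, norm_mul, h2, absWedgeIntegral]
  calc _ ≤ 1 / Real.pi * (C * ∫ ζ, boundIntegrand δ ε p.2 ζ) := by gcongr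
    _ = _ := by field_simp

lemma integral_boundIntegrand_le (δ : Fin k) {ε : ℝ} (hε : 0 < ε) (w : Fin k → ℂ) :
    absWedgeIntegral (boundIntegrand δ ε w) ≤ 2 * ∫ ζ, cauchyKernel ε ζ (w δ + ζ) := by
  rw [absWedgeIntegral]
  gcongr
  · exact integrable_boundIntegrand δ hε w
  · exact integrable_cauchyKernel hε _
  · exact fun ζ => boundIntegrand_le _ _ _ _

lemma FiberDecay.norm_cauchyTransform_le_integral {K : Set (Fin n → ℂ)} {b : ZW n k → ℂ} {ε C : ℝ}
    (h : FiberDecay b K ε C) (hε : 0 < ε) (δ : Fin k) {p : ZW n k} (hp : p.1 ∈ K) :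
    ‖cauchyTransform δ b p‖ ≤ |C| / Real.pi * ∫ ζ, cauchyKernel ε ζ (p.2 δ + ζ) := by
  have hpi := Real.pi_pos
  have h0 : 0 ≤ absWedgeIntegral (boundIntegrand δ ε p.2) :=
    mul_nonneg two_pos.le (integral_nonneg fun ζ => boundIntegrand_nonneg _ _ _ _)
  calc _ ≤ C / (2 * Real.pi) * absWedgeIntegral (boundIntegrand δ ε p.2) :=
        h.norm_cauchyTransform_le hε δ hp
    _ ≤ |C| / (2 * Real.pi) * (2 * ∫ ζ, cauchyKernel ε ζ (p.2 δ + ζ)) := by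
        gcongr
        · exact le_abs_self C
        · exact integral_boundIntegrand_le δ hε p.2
    _ = _ := by field_simp

lemma FiberDecay.exists_bound {K : Set (Fin n → ℂ)} {b : ZW n k → ℂ} {ε C : ℝ}
    (h : FiberDecay b K ε C) (hε : 0 < ε) (δ : Fin k) :
    ∃ M, ∀ p : ZW n k, p.1 ∈ K → ‖cauchyTransform δ b p‖ ≤ M := by
  refine ⟨|C| / Real.pi * (2 * ∫ ζ, cauchyKernel ε ζ ζ), fun p hp => ?_⟩
  refine (h.norm_cauchyTransform_le_integral hε δ hp).trans ?_
  have := Real.pi_pos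
  gcongr
  exact integral_cauchyKernel_le hε _

lemma FiberDecay.exists_forall_lt {K : Set (Fin n → ℂ)} {b : ZW n k → ℂ} {ε C : ℝ}
    (h : FiberDecay b K ε C) (hε : 0 < ε) (δ : Fin k) {θ : ℝ} (hθ : 0 < θ) :
    ∃ M > 0, ∀ p : ZW n k, p.1 ∈ K → M ≤ ‖p.2 δ‖ → ‖cauchyTransform δ b p‖ < θ := by
  have h1 := (tendsto_integral_cauchyKernel hε).const_mul (|C| / Real.pi)
  rw [mul_zero] at h1
  obtain ⟨R, -, hR⟩ := (hasBasis_cobounded_norm (E := ℂ)).eventually_iff.1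
    (h1.eventually_lt_const hθ)
  exact ⟨max R 1, by positivity, fun p hp hM =>
    (h.norm_cauchyTransform_le_integral hε δ hp).trans_lt (hR ((le_max_left _ _).trans hM))⟩

/-! ### Differentiation of the Cauchy transform -/

lemma sum_zDir_add_sum_wDir (v : ZW n k) :
    ∑ β, zDir β (v.1 β) + ∑ γ, wDir γ (v.2 γ) = v := by
  refine Prod.ext ?_ ?_
  · simp [zDir, wDir, Prod.fst_sum, Finset.univ_sum_single]
  · simp [zDir, wDir, Prod.snd_sum, Finset.univ_sum_single]

lemma norm_le_of_realCoordDirs (L : ZW n k →L[ℝ] ℂ) {M : ℝ}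
    (h : ∀ v ∈ realCoordDirs n k, ‖L v‖ ≤ M) : ‖L‖ ≤ (2 * n + 2 * k) * M := by
  have hsplit : ∀ (f : ℂ →L[ℝ] ZW n k) (c : ℂ), ‖L (f 1)‖ ≤ M → ‖L (f Complex.I)‖ ≤ M →
      ‖L (f c)‖ ≤ 2 * ‖c‖ * M := by
    intro f c h1 h2
    have hc : c = c.re • (1 : ℂ) + c.im • Complex.I := by simp
    have hM : 0 ≤ M := (norm_nonneg _).trans h1
    calc ‖L (f c)‖ = ‖c.re • L (f 1) + c.im • L (f Complex.I)‖ := by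
          conv_lhs => rw [hc]
          simp only [map_add, map_smul]
      _ ≤ |c.re| * ‖L (f 1)‖ + |c.im| * ‖L (f Complex.I)‖ := by
          refine (norm_add_le _ _).trans_eq ?_
          rw [norm_smul, norm_smul, Real.norm_eq_abs, Real.norm_eq_abs]
      _ ≤ ‖c‖ * M + ‖c‖ * M := by
          gcongr
          exacts [Complex.abs_re_le_norm c, Complex.abs_im_le_norm c]
      _ = _ := by ring
  let zDirL : Fin n → ℂ →L[ℝ] ZW n k := fun β =>
    (ContinuousLinearMap.inl ℝ (Fin n → ℂ) (Fin k → ℂ)).comp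
      (ContinuousLinearMap.single ℝ (fun _ : Fin n => ℂ) β)
  have hz : ∀ β c, ‖L (zDir β c)‖ ≤ 2 * ‖c‖ * M := fun β c =>
    hsplit (zDirL β) c (h _ (Or.inl ⟨β, Or.inl rfl⟩)) (h _ (Or.inl ⟨β, Or.inr rfl⟩))
  have hw : ∀ γ c, ‖L (wDir γ c)‖ ≤ 2 * ‖c‖ * M := fun γ c =>
    hsplit (wDirL γ) c (h _ (Or.inr ⟨γ, Or.inl rfl⟩)) (h _ (Or.inr ⟨γ, Or.inr rfl⟩))
  have hM : n = 0 ∧ k = 0 ∨ 0 ≤ M := by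
    rcases n.eq_zero_or_pos with hn | hn
    · rcases k.eq_zero_or_pos with hk | hk
      · exact Or.inl ⟨hn, hk⟩
      · exact Or.inr ((norm_nonneg _).trans (h _ (Or.inr ⟨⟨0, hk⟩, Or.inl rfl⟩)))
    · exact Or.inr ((norm_nonneg _).trans (h _ (Or.inl ⟨⟨0, hn⟩, Or.inl rfl⟩)))
  have hnonneg : 0 ≤ (2 * n + 2 * k) * M := by
    rcases hM with ⟨rfl, rfl⟩ | hM
    · simp
    · positivity
  refine L.opNorm_le_bound hnonneg fun v => ?_
  rw [← sum_zDir_add_sum_wDir v, map_add, map_sum, map_sum]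
  rw [sum_zDir_add_sum_wDir v]
  have h1 : ‖∑ β, L (zDir β (v.1 β))‖ ≤ ∑ _β : Fin n, 2 * ‖v‖ * M := by
    refine norm_sum_le_of_le _ fun β _ => (hz β _).trans ?_
    have : 0 ≤ M := (norm_nonneg _).trans (h _ (Or.inl ⟨β, Or.inl rfl⟩))
    gcongr
    exact (norm_le_pi_norm _ β).trans (norm_fst_le v)
  have h2 : ‖∑ γ, L (wDir γ (v.2 γ))‖ ≤ ∑ _γ : Fin k, 2 * ‖v‖ * M := by
    refine norm_sum_le_of_le _ fun γ _ => (hw γ _).trans ?_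
    have : 0 ≤ M := (norm_nonneg _).trans (h _ (Or.inr ⟨γ, Or.inl rfl⟩))
    gcongr
    exact (norm_le_pi_norm _ γ).trans (norm_snd_le v)
  simp only [Finset.sum_const, Finset.card_univ, Fintype.card_fin, nsmul_eq_mul] at h1 h2
  refine (norm_add_le_of_le h1 h2).trans_eq ?_
  ring

/-- A shift of the variable by at most `1` changes the decay factor by a constant factor only. -/
lemma one_add_rpow_le {ε : ℝ} (hε : 0 < ε) {ξ ξ₀ : ℂ} (h : ‖ξ - ξ₀‖ ≤ 1) :
    1 + ‖ξ₀‖ ^ (1 + ε) ≤ (1 + 2 ^ (1 + ε)) * (1 + ‖ξ‖ ^ (1 + ε)) := by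
  have h1 : ‖ξ₀‖ ≤ 2 * max 1 ‖ξ‖ := by
    have : ‖ξ₀‖ ≤ ‖ξ‖ + ‖ξ - ξ₀‖ := by
      rw [norm_sub_rev]
      simpa using norm_add_le ξ (ξ₀ - ξ)
    linarith [le_max_left 1 ‖ξ‖, le_max_right 1 ‖ξ‖]
  have h2 : (max 1 ‖ξ‖) ^ (1 + ε) ≤ 1 + ‖ξ‖ ^ (1 + ε) := by
    have : 0 ≤ ‖ξ‖ ^ (1 + ε) := by positivity
    rcases max_cases 1 ‖ξ‖ with ⟨h, _⟩ | ⟨h, _⟩ <;> rw [h]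
    · simpa using this
    · linarith
  have h3 : ‖ξ₀‖ ^ (1 + ε) ≤ 2 ^ (1 + ε) * (1 + ‖ξ‖ ^ (1 + ε)) := calc
    _ ≤ (2 * max 1 ‖ξ‖) ^ (1 + ε) := by gcongr
    _ = 2 ^ (1 + ε) * (max 1 ‖ξ‖) ^ (1 + ε) := Real.mul_rpow (by norm_num) (by positivity)
    _ ≤ _ := by gcongr
  have : 0 ≤ ‖ξ‖ ^ (1 + ε) := by positivity
  linarith

/-- The derivative in `p` of the integrand `b(p + ζ e_δ) / ζ`. -/
def cauchyDeriv (δ : Fin k) (b : ZW n k → ℂ) (p : ZW n k) (ζ : ℂ) : ZW n k →L[ℝ] ℂ :=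
  (1 / ζ) • fderiv ℝ b (p + wDir δ ζ)

/-- Near each point, the derivatives of the integrand have a common integrable bound. -/
lemma FiberDecay.exists_cauchyDeriv_bound {K : Set (Fin n → ℂ)} {b : ZW n k → ℂ} {ε C : ℝ}
    (h : FiberDecay b K ε C) (hε : 0 < ε) (δ : Fin k) (p₀ : ZW n k) :
    ∃ M : ℝ, ∀ p ∈ Metric.closedBall p₀ 1, p.1 ∈ K → ∀ ζ,
      ‖cauchyDeriv δ b p ζ‖ ≤ M * cauchyKernel ε ζ (p₀.2 δ + ζ) := by
  refine ⟨(2 * n + 2 * k) * (|C| * (1 + 2 ^ (1 + ε))), fun p hp hpK ζ => ?_⟩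
  have hw : ‖(p.2 δ + ζ) - (p₀.2 δ + ζ)‖ ≤ 1 := by
    have h1 : ‖p - p₀‖ ≤ 1 := by simpa [dist_eq_norm] using hp
    calc _ = ‖(p - p₀).2 δ‖ := by simp
      _ ≤ ‖(p - p₀).2‖ := norm_le_pi_norm _ δ
      _ ≤ _ := (norm_snd_le _).trans h1
  have hle := one_add_rpow_le hε hw
  have hL : ∀ v ∈ realCoordDirs n k, ‖fderiv ℝ b (p + wDir δ ζ) v‖ ≤
      |C| * (1 + 2 ^ (1 + ε)) * (1 / (1 + ‖p₀.2 δ + ζ‖ ^ (1 + ε))) := by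
    intro v hv
    have h1 := (h (p + wDir δ ζ).1 (by rwa [add_wDir_fst]) (p + wDir δ ζ).2).2 v hv
    rw [decay_add_wDir, ← add_assoc] at h1
    have h0 : 0 ≤ ∑ γ ∈ Finset.univ.erase δ, ‖p.2 γ‖ ^ (1 + ε) := by positivity
    calc _ ≤ _ := h1
      _ ≤ |C| / (1 + ‖p.2 δ + ζ‖ ^ (1 + ε)) := by
        gcongr
        · exact le_abs_self C
        · linarith
      _ ≤ _ := by
        rw [mul_one_div, div_le_div_iff₀ (by positivity) (by positivity), mul_assoc]
        gcongr
  rw [cauchyDeriv, norm_smul, norm_div, norm_one]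
  calc _ ≤ 1 / ‖ζ‖ * ((2 * n + 2 * k) *
          (|C| * (1 + 2 ^ (1 + ε)) * (1 / (1 + ‖p₀.2 δ + ζ‖ ^ (1 + ε))))) := by
        gcongr
        exact norm_le_of_realCoordDirs _ hL
    _ = _ := by rw [cauchyKernel]; ring

/-- The function `b` decays along the fibres, locally uniformly in `z ∈ U`. -/
def LocallyFiberDecay (b : ZW n k → ℂ) (U : Set (Fin n → ℂ)) : Prop :=
  ∀ K ⊆ U, IsCompact K → ∃ ε > (0 : ℝ), ∃ C : ℝ, FiberDecay b K ε C

section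

variable {U : Set (Fin n → ℂ)} {b : ZW n k → ℂ}

lemma continuousOn_fderiv_of_contDiffOn (hU : IsOpen U)
    (hb : ContDiffOn ℝ 1 b (U ×ˢ Set.univ)) : ContinuousOn (fderiv ℝ b) (U ×ˢ Set.univ) :=
  hb.continuousOn_fderiv_of_isOpen (hU.prod isOpen_univ) le_rfl

lemma aestronglyMeasurable_cauchyDeriv (hU : IsOpen U) (hb : ContDiffOn ℝ 1 b (U ×ˢ Set.univ))
    (δ : Fin k) {p : ZW n k} (hp : p.1 ∈ U) : AEStronglyMeasurable (cauchyDeriv δ b p) := by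
  have h1 : Measurable fun ζ : ℂ => 1 / ζ := by fun_prop
  exact h1.aestronglyMeasurable.smul (continuous_comp_add_wDir
    (continuousOn_fderiv_of_contDiffOn hU hb) δ hp).aestronglyMeasurable

/-- A neighbourhood of `p₀` on which the derivatives of the integrand have a common integrable
bound. -/
lemma LocallyFiberDecay.exists_nhds_bound (hU : IsOpen U) (hd : LocallyFiberDecay b U) (δ : Fin k)
    {p₀ : ZW n k} (hp₀ : p₀.1 ∈ U) :
    ∃ V ∈ 𝓝 p₀, ∃ g : ℂ → ℝ, Integrable g ∧ ∀ p ∈ V, p.1 ∈ U ∧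
      ∀ ζ, ‖cauchyDeriv δ b p ζ‖ ≤ g ζ := by
  obtain ⟨r, hr, hrU⟩ := Metric.nhds_basis_closedBall.mem_iff.1 (hU.mem_nhds hp₀)
  obtain ⟨ε, hε, C, hC⟩ := hd _ hrU (isCompact_closedBall _ _)
  obtain ⟨M, hM⟩ := hC.exists_cauchyDeriv_bound hε δ p₀
  refine ⟨Metric.closedBall p₀ (min r 1), Metric.closedBall_mem_nhds _ (by positivity), _,
    (integrable_cauchyKernel hε (p₀.2 δ)).const_mul M, fun p hp => ?_⟩
  have h1 : p.1 ∈ Metric.closedBall p₀.1 r := by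
    have : dist p.1 p₀.1 ≤ dist p p₀ := le_max_left _ _
    exact this.trans (hp.trans (min_le_left _ _))
  exact ⟨hrU h1, hM p (Metric.closedBall_subset_closedBall (min_le_right _ _) hp) h1⟩

lemma LocallyFiberDecay.integrable (hb : ContDiffOn ℝ 1 b (U ×ˢ Set.univ))
    (hd : LocallyFiberDecay b U) (δ : Fin k) {p : ZW n k} (hp : p.1 ∈ U) :
    Integrable fun ζ => b (p + wDir δ ζ) / ζ := by
  obtain ⟨ε, hε, C, hC⟩ := hd {p.1} (by simpa using hp) isCompact_singleton
  exact hC.integrable hε hb.continuousOn (by simpa using hp) δ rfl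

lemma LocallyFiberDecay.integrable_cauchyDeriv (hU : IsOpen U)
    (hb : ContDiffOn ℝ 1 b (U ×ˢ Set.univ)) (hd : LocallyFiberDecay b U) (δ : Fin k) {p : ZW n k}
    (hp : p.1 ∈ U) : Integrable (cauchyDeriv δ b p) := by
  obtain ⟨V, hV, g, hg, hVg⟩ := hd.exists_nhds_bound hU δ hp
  exact hg.mono' (aestronglyMeasurable_cauchyDeriv hU hb δ hp)
    (Eventually.of_forall (hVg p (mem_of_mem_nhds hV)).2)

lemma LocallyFiberDecay.hasFDerivAt (hU : IsOpen U) (hb : ContDiffOn ℝ 1 b (U ×ˢ Set.univ))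
    (hd : LocallyFiberDecay b U) (δ : Fin k) {p : ZW n k} (hp : p.1 ∈ U) :
    HasFDerivAt (cauchyTransform δ b)
      (-(1 / Real.pi : ℂ) • ∫ ζ, cauchyDeriv δ b p ζ) p := by
  have hfun : cauchyTransform δ b =
      fun p => -(1 / Real.pi : ℂ) • ∫ ζ, b (p + wDir δ ζ) / ζ :=
    funext fun p => cauchyTransform_eq δ b p
  rw [hfun]
  obtain ⟨V, hV, g, hg, hVg⟩ := hd.exists_nhds_bound hU δ hp
  suffices h : HasFDerivAt (fun p => ∫ ζ, b (p + wDir δ ζ) / ζ) (∫ ζ, cauchyDeriv δ b p ζ) p from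
    h.const_smul (-(1 / Real.pi : ℂ))
  refine hasFDerivAt_integral_of_dominated_of_fderiv_le (F' := cauchyDeriv δ b) (bound := g) hV ?_
    (hd.integrable hb δ hp) (aestronglyMeasurable_cauchyDeriv hU hb δ hp)
    (Eventually.of_forall fun ζ q hq => (hVg q hq).2 ζ) hg
    (Eventually.of_forall fun ζ q hq => ?_)
  · filter_upwards [hV] with q hq
    exact (hd.integrable hb δ (hVg q hq).1).aestronglyMeasurable
  · have hmem : q + wDir δ ζ ∈ U ×ˢ (Set.univ : Set (Fin k → ℂ)) :=
      ⟨by rw [add_wDir_fst]; exact (hVg q hq).1, trivial⟩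
    have h1 : HasFDerivAt b (fderiv ℝ b (q + wDir δ ζ)) (q + wDir δ ζ) :=
      ((hb.differentiableOn one_ne_zero).differentiableAt
        ((hU.prod isOpen_univ).mem_nhds hmem)).hasFDerivAt
    have h2 := (HasFDerivAt.comp q h1 ((hasFDerivAt_id q).add_const (wDir δ ζ))).const_smul (1 / ζ)
    refine h2.congr_of_eventuallyEq (Eventually.of_forall fun x => ?_)
    simp [div_eq_inv_mul]

lemma LocallyFiberDecay.contDiffOn (hU : IsOpen U) (hb : ContDiffOn ℝ 1 b (U ×ˢ Set.univ))
    (hd : LocallyFiberDecay b U) (δ : Fin k) :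
    ContDiffOn ℝ 1 (cauchyTransform δ b) (U ×ˢ Set.univ) := by
  have hopen := hU.prod (isOpen_univ (X := Fin k → ℂ))
  rw [← zero_add (1 : WithTop ℕ∞), contDiffOn_succ_iff_fderiv_of_isOpen hopen, contDiffOn_zero]
  refine ⟨fun p hp => (hd.hasFDerivAt hU hb δ hp.1).differentiableAt.differentiableWithinAt,
    by simp, ?_⟩
  have h1 : ContinuousOn (fun p => -(1 / Real.pi : ℂ) • ∫ ζ, cauchyDeriv δ b p ζ)
      (U ×ˢ Set.univ) := by
    suffices h : ContinuousOn (fun p => ∫ ζ, cauchyDeriv δ b p ζ) (U ×ˢ Set.univ) from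
      h.const_smul (-(1 / Real.pi : ℂ))
    refine fun p hp => ContinuousAt.continuousWithinAt ?_
    obtain ⟨V, hV, g, hg, hVg⟩ := hd.exists_nhds_bound hU δ hp.1
    refine continuousAt_of_dominated (bound := g) ?_ ?_ hg (Eventually.of_forall fun ζ => ?_)
    · filter_upwards [hV] with q hq
      exact aestronglyMeasurable_cauchyDeriv hU hb δ (hVg q hq).1
    · filter_upwards [hV] with q hq
      exact Eventually.of_forall (hVg q hq).2
    · have hmem : p + wDir δ ζ ∈ U ×ˢ (Set.univ : Set (Fin k → ℂ)) :=
        ⟨by rw [add_wDir_fst]; exact hp.1, trivial⟩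
      have h2 : ContinuousAt (fderiv ℝ b) (p + wDir δ ζ) :=
        (continuousOn_fderiv_of_contDiffOn hU hb).continuousAt (hopen.mem_nhds hmem)
      exact (ContinuousAt.comp (f := fun q => q + wDir δ ζ) (x := p) h2
        (continuous_add_const _).continuousAt).const_smul (1 / ζ)
  exact h1.congr fun p hp => (hd.hasFDerivAt hU hb δ hp.1).fderiv

lemma dbarC_comp_add_wDir {a : ZW n k → ℂ} (δ : Fin k) {p : ZW n k} {ζ : ℂ}
    (ha : DifferentiableAt ℝ a (p + wDir δ ζ)) :
    dbarC (fun ζ => a (p + wDir δ ζ)) ζ =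
      antilinearPart (fderiv ℝ a (p + wDir δ ζ)) (wDir δ 1) := by
  have h1 : HasFDerivAt (fun ζ => p + wDir δ ζ) (wDirL (n := n) δ) ζ :=
    (wDirL δ).hasFDerivAt.const_add p
  have h2 := (HasFDerivAt.comp (f := fun ζ => p + wDir δ ζ) ζ ha.hasFDerivAt h1).fderiv
  have h3 : Complex.I • wDir (n := n) δ 1 = wDir δ Complex.I := by
    simp [wDir, ← Pi.single_smul]
  change _ * (fderiv ℝ (a ∘ fun ζ => p + wDir δ ζ) ζ 1 + _ * fderiv ℝ (a ∘ fun ζ => p + wDir δ ζ) ζ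
    Complex.I) = _
  rw [h2, antilinearPart_apply, h3]
  rfl

/-- If the conjugate-linear derivative of `b` in the direction `v` is `∂a/∂w̄_δ` for a function `a`
vanishing at infinity along the fibres, then that of the Cauchy transform of `b` is `a`: the
derivative passes under the integral sign, and the integral is the Cauchy–Pompeiu integral of `a`
along the line through `p` in the direction of `w_δ`. -/
lemma LocallyFiberDecay.antilinearPart_fderiv_cauchyTransform (hU : IsOpen U)
    (hb : ContDiffOn ℝ 1 b (U ×ˢ Set.univ)) (hd : LocallyFiberDecay b U) (δ : Fin k)
    {a : ZW n k → ℂ} (ha : ContDiffOn ℝ 1 a (U ×ˢ Set.univ)) {v : ZW n k}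
    {p : ZW n k} (hp : p.1 ∈ U)
    (hva : ∀ q ∈ U ×ˢ (Set.univ : Set (Fin k → ℂ)),
      antilinearPart (fderiv ℝ b q) v = dwbar δ a q)
    (ha0 : Tendsto (fun ζ => a (p + wDir δ ζ)) (Bornology.cobounded ℂ) (𝓝 0)) :
    antilinearPart (fderiv ℝ (cauchyTransform δ b) p) v = a p := by
  have hopen := hU.prod (isOpen_univ (X := Fin k → ℂ))
  have hmem : ∀ ζ, p + wDir δ ζ ∈ U ×ˢ (Set.univ : Set (Fin k → ℂ)) := fun ζ =>
    ⟨by rw [add_wDir_fst]; exact hp, trivial⟩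
  have hi := hd.integrable_cauchyDeriv hU hb δ hp
  have hiv : ∀ u, Integrable fun ζ => cauchyDeriv δ b p ζ u := fun u =>
    hi.apply_continuousLinearMap u
  set f : ℂ → ℂ := fun ζ => a (p + wDir δ ζ)
  have hf : ContDiff ℝ 1 f := by
    refine contDiff_iff_contDiffAt.2 fun ζ => ?_
    have h1 : ContDiffAt ℝ 1 (fun ζ => p + wDir δ ζ) ζ :=
      (contDiff_const.add (wDirL (n := n) δ).contDiff).contDiffAt
    exact ContDiffAt.comp ζ (ha.contDiffAt (hopen.mem_nhds (hmem ζ))) h1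
  have hfd : ∀ ζ, dbarC f ζ / ζ = (1 / 2 : ℂ) * (cauchyDeriv δ b p ζ v +
      Complex.I * cauchyDeriv δ b p ζ (Complex.I • v)) := by
    intro ζ
    rw [dbarC_comp_add_wDir δ ((ha.differentiableOn one_ne_zero).differentiableAt
      (hopen.mem_nhds (hmem ζ)))]
    change dwbar δ a _ / ζ = _
    rw [← hva _ (hmem ζ), antilinearPart_apply]
    simp only [cauchyDeriv, smul_apply, smul_eq_mul]
    ring
  have hint : Integrable fun ζ => dbarC f ζ / ζ := by
    simp only [hfd]
    exact ((hiv v).add ((hiv _).const_mul _)).const_mul _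
  have hmain := integral_dbarC_div_eq hf ha0 hint
  have hpi : (Real.pi : ℂ) ≠ 0 := Complex.ofReal_ne_zero.2 Real.pi_ne_zero
  have hf0 : f 0 = a p := by simp [f, ← wDirL_apply]
  simp only [hfd] at hmain
  rw [integral_const_mul, integral_add (hiv v) ((hiv _).const_mul _), integral_const_mul,
    ← ContinuousLinearMap.integral_apply hi, ← ContinuousLinearMap.integral_apply hi] at hmain
  rw [(hd.hasFDerivAt hU hb δ hp).fderiv, antilinearPart_apply]
  simp only [smul_apply, smul_eq_mul]
  rw [← hf0]
  have e : -(1 / Real.pi : ℂ) * (-Real.pi * f 0) = f 0 := by field_simp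
  rw [← e, ← hmain]
  ring

end

/-! ### Conjugate-linear forms -/

lemma antilinear_ext {A A' : ZW n k →L⋆[ℂ] ℂ} (hz : ∀ α, A (zDir α 1) = A' (zDir α 1))
    (hw : ∀ γ, A (wDir γ 1) = A' (wDir γ 1)) : A = A' := by
  ext v
  have h1 : ∀ (α : Fin n) (c : ℂ), zDir (k := k) α c = c • zDir α 1 := fun α c => by
    simp [zDir, ← Pi.single_smul]
  have h2 : ∀ (γ : Fin k) (c : ℂ), wDir (n := n) γ c = c • wDir γ 1 := fun γ c => by
    simp [wDir, ← Pi.single_smul]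
  rw [← sum_zDir_add_sum_wDir v]
  simp only [map_add, map_sum]
  congr 1
  · exact Finset.sum_congr rfl fun α _ => by rw [h1, map_smulₛₗ, map_smulₛₗ, hz]
  · exact Finset.sum_congr rfl fun γ _ => by rw [h2, map_smulₛₗ, map_smulₛₗ, hw]

lemma antilinearPart_comp (L : ZW n k →L[ℝ] ℂ) (M : ZW n k →L[ℂ] ZW n k) (v : ZW n k) :
    antilinearPart (L.comp (M.restrictScalars ℝ)) v = antilinearPart L (M v) := by
  simp [antilinearPart_apply]

lemma antilinearPart_sub (L L' : ZW n k →L[ℝ] ℂ) (v : ZW n k) :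
    antilinearPart (L - L') v = antilinearPart L v - antilinearPart L' v := by
  simp only [antilinearPart_apply, sub_apply]
  ring

/-- The Cauchy–Riemann equations. -/
lemma differentiableAt_complex_of_antilinearPart_eq_zero {f : ZW n k → ℂ} {p : ZW n k}
    (hf : DifferentiableAt ℝ f p) (h : ∀ v, antilinearPart (fderiv ℝ f p) v = 0) :
    DifferentiableAt ℂ f p := by
  set L := fderiv ℝ f p
  have hI : ∀ v, L (Complex.I • v) = Complex.I * L v := by
    intro v
    have h1 := h v
    rw [antilinearPart_apply] at h1
    linear_combination (-2 * Complex.I) * h1 + L (Complex.I • v) * Complex.I_sq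
  let L' : ZW n k →L[ℂ] ℂ :=
    { toFun := L
      map_add' := L.map_add
      map_smul' := fun c v => by
        have e : c • v = c.re • v + c.im • (Complex.I • v) := by
          ext i <;> simp <;> nth_rewrite 1 [← Complex.re_add_im c] <;> ring
        rw [e, map_add, map_smul, map_smul, hI, RingHom.id_apply, Complex.real_smul,
          Complex.real_smul, smul_eq_mul]
        nth_rewrite 3 [← Complex.re_add_im c]
        ring
      cont := L.cont }
  exact (hasFDerivAt_of_restrictScalars ℝ (f' := L') hf.hasFDerivAt rfl).differentiableAt

/-! ### Forms and functions in charts -/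

section Charts

variable {X : Type*} [TopologicalSpace X] [ChartedSpace (ZW n k) X]

lemma contDiffAt_transition {e e' : OpenPartialHomeomorph X (ZW n k)}
    (he : e ∈ IsManifold.maximalAtlas 𝓘(ℂ, ZW n k) ω X)
    (he' : e' ∈ IsManifold.maximalAtlas 𝓘(ℂ, ZW n k) ω X) {p : ZW n k} (hp : p ∈ e.target)
    (hp' : e.symm p ∈ e'.source) : ContDiffAt ℂ ω (fun q => e' (e.symm q)) p := by
  have h1 : ContMDiffAt 𝓘(ℂ, ZW n k) 𝓘(ℂ, ZW n k) ω e.symm p :=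
    (contMDiffOn_symm_of_mem_maximalAtlas he).contMDiffAt (e.open_target.mem_nhds hp)
  have h2 : ContMDiffAt 𝓘(ℂ, ZW n k) 𝓘(ℂ, ZW n k) ω e' (e.symm p) :=
    (contMDiffOn_of_mem_maximalAtlas he').contMDiffAt (e'.open_source.mem_nhds hp')
  exact (ContMDiffAt.comp p h2 h1).contDiffAt

lemma mdifferentiable_of_mem_maximalAtlas {e : OpenPartialHomeomorph X (ZW n k)}
    (he : e ∈ IsManifold.maximalAtlas 𝓘(ℂ, ZW n k) ω X) :
    e.MDifferentiable 𝓘(ℂ, ZW n k) 𝓘(ℂ, ZW n k) :=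
  ⟨(contMDiffOn_of_mem_maximalAtlas he).mdifferentiableOn (by simp),
    (contMDiffOn_symm_of_mem_maximalAtlas he).mdifferentiableOn (by simp)⟩

lemma zeroOneForm_congr (η : ZeroOneForm n k X) {x y : X} (h : x = y) (v : ZW n k) :
    η x v = η y v := by
  subst h; rfl

/-- A function that is `b` in the chart `e` is of class `C¹` where `b` is, and `∂̄` of it, read in
the chart, is the conjugate-linear part of the differential of `b`. -/
lemma contMDiffAt_and_dbar_of_eqOn_chart {e : OpenPartialHomeomorph X (ZW n k)}
    [IsManifold 𝓘(ℂ, ZW n k) ω X]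
    (he : e ∈ IsManifold.maximalAtlas 𝓘(ℂ, ZW n k) ω X) {p : ZW n k} (hp : p ∈ e.target)
    {B : X → ℂ} {b : ZW n k → ℂ} (hb : ContDiffAt ℝ 1 b p)
    (hB : ∀ q ∈ e.target, B (e.symm q) = b q) :
    ContMDiffAt 𝓘(ℝ, ZW n k) 𝓘(ℝ, ℂ) 1 B (e.symm p) ∧
      ∀ v : ZW n k, dbar B (e.symm p)
        (mfderiv 𝓘(ℂ, ZW n k) 𝓘(ℂ, ZW n k) e.symm p v) = antilinearPart (fderiv ℝ b p) v := by
  set x := e.symm p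
  set c := chartAt (ZW n k) x
  have hc : c ∈ IsManifold.maximalAtlas 𝓘(ℂ, ZW n k) ω X := IsManifold.chart_mem_maximalAtlas x
  have hxc : x ∈ c.source := mem_chart_source _ x
  have hxe : x ∈ e.source := e.map_target hp
  have hcx : c x ∈ c.target := c.map_source hxc
  have hex : e (c.symm (c x)) = p := by rw [c.left_inv hxc]; exact e.right_inv hp
  have hBx : B =ᶠ[𝓝 x] b ∘ e := by
    filter_upwards [e.open_source.mem_nhds hxe] with y hy
    rw [Function.comp_apply, ← hB _ (e.map_source hy), e.left_inv hy]
  -- `B` in the preferred chart at `x`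
  have hBc : B ∘ c.symm =ᶠ[𝓝 (c x)] b ∘ fun q => e (c.symm q) := by
    have h1 : Tendsto c.symm (𝓝 (c x)) (𝓝 x) := by
      have := c.continuousAt_symm hcx
      rwa [ContinuousAt, c.left_inv hxc] at this
    exact h1.eventually hBx
  have hcd : ContDiffAt ℝ 1 (B ∘ c.symm) (c x) := by
    have h1 : ContDiffAt ℝ 1 (fun q => e (c.symm q)) (c x) :=
      ((contDiffAt_transition hc he hcx (by rwa [c.left_inv hxc])).of_le (by simp)).restrict_scalars ℝ
    refine (ContDiffAt.comp (c x) ?_ h1).congr_of_eventuallyEq hBc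
    rwa [hex]
  have hcont : ContMDiffAt 𝓘(ℝ, ZW n k) 𝓘(ℝ, ℂ) 1 B x := by
    rw [contMDiffAt_iff]
    refine ⟨?_, ?_⟩
    · refine ContinuousAt.congr ?_ hBx.symm
      refine ContinuousAt.comp ?_ (e.continuousAt hxe)
      have : e x = p := e.right_inv hp
      rw [this]
      exact hb.continuousAt
    · rw [ModelWithCorners.range_eq_univ]
      exact hcd.contDiffWithinAt
  refine ⟨hcont, fun v => ?_⟩
  have hmB : mfderiv 𝓘(ℝ, ZW n k) 𝓘(ℝ, ℂ) B x = fderiv ℝ (B ∘ c.symm) (c x) := by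
    refine (hcont.mdifferentiableAt one_ne_zero).mfderiv.trans ?_
    rw [ModelWithCorners.range_eq_univ, fderivWithin_univ]
    rfl
  have hme : mfderiv 𝓘(ℂ, ZW n k) 𝓘(ℂ, ZW n k) e.symm p = fderiv ℂ (fun q => c (e.symm q)) p := by
    refine ((mdifferentiable_of_mem_maximalAtlas he).mdifferentiableAt_symm hp).mfderiv.trans ?_
    rw [ModelWithCorners.range_eq_univ, fderivWithin_univ]
    rfl
  have htr : DifferentiableAt ℂ (fun q => c (e.symm q)) p :=
    (contDiffAt_transition he hc hp hxc).differentiableAt (by simp)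
  have hbp : b =ᶠ[𝓝 p] (B ∘ c.symm) ∘ fun q => c (e.symm q) := by
    have h1 : ∀ᶠ q in 𝓝 p, e.symm q ∈ c.source :=
      (e.continuousAt_symm hp).eventually (c.open_source.mem_nhds hxc)
    filter_upwards [h1, e.open_target.mem_nhds hp] with q hq hqe
    simp only [Function.comp_apply]
    rw [c.left_inv hq, hB q hqe]
  have hfb : fderiv ℝ b p = (fderiv ℝ (B ∘ c.symm) (c x)).comp
      ((fderiv ℂ (fun q => c (e.symm q)) p).restrictScalars ℝ) := by
    rw [hbp.fderiv_eq]
    exact (HasFDerivAt.comp p (hcd.differentiableAt one_ne_zero).hasFDerivAt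
      (htr.hasFDerivAt.restrictScalars ℝ)).fderiv
  rw [hfb, antilinearPart_comp, ← hme, ← hmB]
  rfl

end Charts

namespace HolomorphicFiberBundle

variable {X : Type*} [TopologicalSpace X] [ChartedSpace (ZW n k) X] {S : Type*}
  (F : HolomorphicFiberBundle n k X S) (η : ZeroOneForm n k X)

/-- The form `η` in the chart `s` at the point `p`, as a conjugate-linear form. -/
def formInChartL (s : S) (p : ZW n k) : ZW n k →L⋆[ℂ] ℂ :=
  ContinuousLinearMap.comp (η ((F.chart s).symm p))
    (mfderiv 𝓘(ℂ, ZW n k) 𝓘(ℂ, ZW n k) (F.chart s).symm p)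

lemma formInChartL_apply (s : S) (p v : ZW n k) : F.formInChartL η s p v = F.formInChart η s p v :=
  rfl

variable {F η}

/-- The coefficients transform by pullback along the transition maps. -/
lemma formInChart_transition {s t : S} {p : ZW n k} (hp : p ∈ (F.chart t).target)
    (hps : (F.chart t).symm p ∈ (F.chart s).source) (v : ZW n k) :
    F.formInChart η t p v = F.formInChart η s (F.chart s ((F.chart t).symm p))
      (fderiv ℂ (fun q => F.chart s ((F.chart t).symm q)) p v) := by
  set φ : ZW n k → ZW n k := fun q => F.chart s ((F.chart t).symm q)
  have heq : ((F.chart t).symm : ZW n k → X) =ᶠ[𝓝 p] (F.chart s).symm ∘ φ := by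
    filter_upwards [((F.chart t).continuousAt_symm hp).eventually
      ((F.chart s).open_source.mem_nhds hps)] with q hq
    exact ((F.chart s).left_inv hq).symm
  have hφ : DifferentiableAt ℂ φ p :=
    (contDiffAt_transition (F.chart_mem t) (F.chart_mem s) hp hps).differentiableAt (by simp)
  have hs := (mdifferentiable_of_mem_maximalAtlas (F.chart_mem s)).mdifferentiableAt_symm
    ((F.chart s).map_source hps)
  have hm : mfderiv 𝓘(ℂ, ZW n k) 𝓘(ℂ, ZW n k) ((F.chart s).symm ∘ φ) p v =
      mfderiv 𝓘(ℂ, ZW n k) 𝓘(ℂ, ZW n k) (F.chart s).symm (φ p) (fderiv ℂ φ p v) := by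
    rw [mfderiv_comp (I' := 𝓘(ℂ, ZW n k)) p hs hφ.mdifferentiableAt, mfderiv_eq_fderiv]
    rfl
  rw [formInChart, formInChart, heq.mfderiv_eq]
  refine (zeroOneForm_congr η ((F.chart s).left_inv hps).symm _).trans ?_
  exact congrArg _ hm

end HolomorphicFiberBundle

namespace HolomorphicFiberBundle

variable {X : Type*} [TopologicalSpace X] [ChartedSpace (ZW n k) X] {S : Type*}
  {F : HolomorphicFiberBundle n k X S} {η : ZeroOneForm n k X}

/-! ### The solution in one chart -/

/-- The solution in the chart `s`: the Cauchy transform of `b_δ` in the variable `w_δ`. -/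
def localSolution (F : HolomorphicFiberBundle n k X S) (η : ZeroOneForm n k X) (s : S)
    (δ : Fin k) : ZW n k → ℂ :=
  cauchyTransform δ (F.bCoeff η s δ)

lemma IsDecreasing.locallyFiberDecay (h : F.IsDecreasing η) (s : S) (γ : Fin k) :
    LocallyFiberDecay (F.bCoeff η s γ) (F.U s) := fun K hK hKc => by
  obtain ⟨ε, hε, C, hC⟩ := (h s K hK hKc).2
  exact ⟨ε, hε, C, hC γ⟩

lemma mem_target {s : S} {p : ZW n k} : p ∈ (F.chart s).target ↔ p.1 ∈ F.U s := by
  simp [F.target_eq s]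

lemma IsC1Form.contDiffOn_bCoeff (hC1 : F.IsC1Form η) (s : S) (γ : Fin k) :
    ContDiffOn ℝ 1 (F.bCoeff η s γ) (F.U s ×ˢ Set.univ) := by
  have h := (hC1 s).2 γ
  rwa [F.target_eq s] at h

lemma IsC1Form.contDiffOn_aCoeff (hC1 : F.IsC1Form η) (s : S) (α : Fin n) :
    ContDiffOn ℝ 1 (F.aCoeff η s α) (F.U s ×ˢ Set.univ) := by
  have h := (hC1 s).1 α
  rwa [F.target_eq s] at h

lemma norm_le_euclLength (w : Fin k → ℂ) (δ : Fin k) : ‖w δ‖ ≤ euclLength w := by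
  refine Real.le_sqrt_of_sq_le ?_
  exact Finset.single_le_sum (f := fun γ => ‖w γ‖ ^ 2) (fun γ _ => by positivity)
    (Finset.mem_univ δ)

lemma tendsto_norm_add_wDir (δ : Fin k) (p : ZW n k) :
    Tendsto (fun ζ => ‖(p + wDir δ ζ).2 δ‖) (Bornology.cobounded ℂ) atTop := by
  simp only [add_wDir_apply_same]
  exact tendsto_norm_cobounded_atTop.comp (tendsto_const_add_cobounded (p.2 δ))

lemma IsDecreasing.tendsto_aCoeff (h : F.IsDecreasing η) (s : S) (α : Fin n) (δ : Fin k)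
    {p : ZW n k} (hp : p.1 ∈ F.U s) :
    Tendsto (fun ζ => F.aCoeff η s α (p + wDir δ ζ)) (Bornology.cobounded ℂ) (𝓝 0) := by
  rw [Metric.tendsto_nhds]
  intro θ hθ
  obtain ⟨M, -, hM⟩ := (h s {p.1} (by simpa using hp) isCompact_singleton).1 α θ hθ
  filter_upwards [(tendsto_norm_add_wDir δ p).eventually_ge_atTop M] with ζ hζ
  rw [dist_zero_right]
  have hmem : (p + wDir δ ζ).1 ∈ ({p.1} : Set (Fin n → ℂ)) := add_wDir_fst δ p ζ
  simpa only [Prod.mk.eta] using hM _ (hζ.trans (norm_le_euclLength _ δ)) _ hmem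

lemma IsDecreasing.tendsto_bCoeff (h : F.IsDecreasing η) (s : S) (γ δ : Fin k)
    {p : ZW n k} (hp : p.1 ∈ F.U s) :
    Tendsto (fun ζ => F.bCoeff η s γ (p + wDir δ ζ)) (Bornology.cobounded ℂ) (𝓝 0) := by
  obtain ⟨ε, hε, C, hC⟩ := (h s {p.1} (by simpa using hp) isCompact_singleton).2
  have h1 : Tendsto (fun ζ => |C| / (1 + ‖(p + wDir δ ζ).2 δ‖ ^ (1 + ε)))
      (Bornology.cobounded ℂ) (𝓝 0) :=
    Tendsto.const_div_atTop (tendsto_atTop_add_const_left _ _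
      ((tendsto_rpow_atTop (by linarith)).comp (tendsto_norm_add_wDir δ p))) _
  refine squeeze_zero_norm (fun ζ => ?_) h1
  refine (hC γ (p + wDir δ ζ).1 (add_wDir_fst δ p ζ) (p + wDir δ ζ).2).1.trans ?_
  have h2 : ‖(p + wDir δ ζ).2 δ‖ ^ (1 + ε) ≤ ∑ γ, ‖(p + wDir δ ζ).2 γ‖ ^ (1 + ε) :=
    Finset.single_le_sum (f := fun γ => ‖(p + wDir δ ζ).2 γ‖ ^ (1 + ε))
      (fun γ _ => by positivity) (Finset.mem_univ δ)
  gcongr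
  exact le_abs_self C

variable (hC1 : F.IsC1Form η) (hclosed : F.IsDbarClosed η) (hdecr : F.IsDecreasing η)

include hC1 hdecr in
lemma contDiffAt_localSolution (s : S) (δ : Fin k) {p : ZW n k} (hp : p ∈ (F.chart s).target) :
    ContDiffAt ℝ 1 (F.localSolution η s δ) p :=
  ((hdecr.locallyFiberDecay s δ).contDiffOn (F.isOpen_U s) (hC1.contDiffOn_bCoeff s δ) δ).contDiffAt
    (((F.isOpen_U s).prod isOpen_univ).mem_nhds ⟨mem_target.1 hp, trivial⟩)

include hC1 hclosed hdecr in
/-- Each Cauchy transform solves `∂̄B = η` in its chart: `∂̄η = 0` turns every `∂̄`-derivative of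
`b_δ` into a `∂/∂w̄_δ` of a coefficient of `η`. -/
lemma antilinearPart_fderiv_localSolution (s : S) (δ : Fin k) {p : ZW n k}
    (hp : p ∈ (F.chart s).target) (v : ZW n k) :
    antilinearPart (fderiv ℝ (F.localSolution η s δ) p) v = F.formInChart η s p v := by
  have hU := mem_target.1 hp
  have hq : ∀ q ∈ F.U s ×ˢ (Set.univ : Set (Fin k → ℂ)), q ∈ (F.chart s).target := fun q hq =>
    mem_target.2 hq.1
  have hd := hdecr.locallyFiberDecay s δ
  have hb := hC1.contDiffOn_bCoeff s δ
  have hL : antilinearPart (fderiv ℝ (F.localSolution η s δ) p) = F.formInChartL η s p := by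
    refine antilinear_ext (fun α => ?_) (fun γ => ?_)
    · exact hd.antilinearPart_fderiv_cauchyTransform (F.isOpen_U s) hb δ
        (hC1.contDiffOn_aCoeff s α) hU (fun q h => ((hclosed s q (hq q h)).2.1 α δ).symm)
        (hdecr.tendsto_aCoeff s α δ hU)
    · exact hd.antilinearPart_fderiv_cauchyTransform (F.isOpen_U s) hb δ
        (hC1.contDiffOn_bCoeff s γ) hU (fun q h => (hclosed s q (hq q h)).2.2 δ γ)
        (hdecr.tendsto_bCoeff s γ δ hU)
  rw [hL, formInChartL_apply]

include hdecr in
lemma exists_bound_localSolution (s : S) (δ : Fin k) {K : Set (Fin n → ℂ)} (hK : K ⊆ F.U s)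
    (hKc : IsCompact K) : ∃ M, ∀ p : ZW n k, p.1 ∈ K → ‖F.localSolution η s δ p‖ ≤ M := by
  obtain ⟨ε, hε, C, hC⟩ := (hdecr s K hK hKc).2
  exact (show FiberDecay _ K ε C from hC δ).exists_bound hε δ

include hdecr in
lemma exists_forall_localSolution_lt (s : S) (δ : Fin k) {K : Set (Fin n → ℂ)} (hK : K ⊆ F.U s)
    (hKc : IsCompact K) {θ : ℝ} (hθ : 0 < θ) :
    ∃ M > 0, ∀ p : ZW n k, p.1 ∈ K → M ≤ ‖p.2 δ‖ → ‖F.localSolution η s δ p‖ < θ := by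
  obtain ⟨ε, hε, C, hC⟩ := (hdecr s K hK hKc).2
  exact (show FiberDecay _ K ε C from hC δ).exists_forall_lt hε δ hθ

/-! ### Comparison of the solutions on a fibre -/

include hC1 hclosed hdecr in
/-- On a fibre two of the local solutions differ by a bounded entire function, hence by a
constant. -/
lemma localSolution_sub_eq {s t : S} (δ δ' : Fin k) {z : Fin n → ℂ} {z' : Fin n → ℂ}
    (hz : z ∈ F.U t) (hz' : z' ∈ F.U s)
    (hmem : ∀ w : Fin k → ℂ, (F.chart t).symm (z, w) ∈ (F.chart s).source)
    (hfst : ∀ w : Fin k → ℂ, (F.chart s ((F.chart t).symm (z, w))).1 = z') (w w' : Fin k → ℂ) :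
    F.localSolution η t δ (z, w) -
        F.localSolution η s δ' (F.chart s ((F.chart t).symm (z, w))) =
      F.localSolution η t δ (z, w') -
        F.localSolution η s δ' (F.chart s ((F.chart t).symm (z, w'))) := by
  set φ : ZW n k → ZW n k := fun q => F.chart s ((F.chart t).symm q)
  let D : ZW n k → ℂ := fun q => F.localSolution η t δ q - F.localSolution η s δ' (φ q)
  have hD : ∀ w, DifferentiableAt ℂ D (z, w) := by
    intro w
    have hp : (z, w) ∈ (F.chart t).target := mem_target.2 hz
    have hφp : φ (z, w) ∈ (F.chart s).target := (F.chart s).map_source (hmem w)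
    have h1 := (contDiffAt_localSolution hC1 hdecr t δ hp).differentiableAt one_ne_zero
    have h2 := (contDiffAt_localSolution hC1 hdecr s δ' hφp).differentiableAt one_ne_zero
    have hφ : DifferentiableAt ℂ φ (z, w) :=
      (contDiffAt_transition (F.chart_mem t) (F.chart_mem s) hp (hmem w)).differentiableAt (by simp)
    have hd := h1.hasFDerivAt.sub
      (HasFDerivAt.comp (z, w) h2.hasFDerivAt (hφ.hasFDerivAt.restrictScalars ℝ))
    refine differentiableAt_complex_of_antilinearPart_eq_zero hd.differentiableAt fun v => ?_
    have hd' : fderiv ℝ D (z, w) = _ := hd.fderiv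
    rw [hd', antilinearPart_sub, antilinearPart_comp,
      antilinearPart_fderiv_localSolution hC1 hclosed hdecr t δ hp,
      antilinearPart_fderiv_localSolution hC1 hclosed hdecr s δ' hφp,
      formInChart_transition hp (hmem w), sub_self]
  have hdiff : Differentiable ℂ fun w => D (z, w) := fun w =>
    DifferentiableAt.comp (f := fun w => (z, w)) w (hD w) (by fun_prop)
  obtain ⟨M, hM⟩ := exists_bound_localSolution hdecr t δ (K := {z}) (by simpa using hz)
    isCompact_singleton
  obtain ⟨M', hM'⟩ := exists_bound_localSolution hdecr s δ' (K := {z'}) (by simpa using hz')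
    isCompact_singleton
  refine hdiff.apply_eq_apply_of_bounded (isBounded_iff_forall_norm_le.2 ⟨M + M', ?_⟩) w w'
  rintro _ ⟨w, rfl⟩
  exact (norm_sub_le _ _).trans (add_le_add (hM _ rfl) (hM' _ (hfst w)))

/-- If a constant difference of two functions tends to zero along a filter, it is zero. -/
lemma eq_of_sub_const_of_tendsto {ι : Type*} {l : Filter ι} [l.NeBot] {u v : ι → ℂ}
    (hconst : ∀ i j, u i - v i = u j - v j) (hu : Tendsto u l (𝓝 0)) (hv : Tendsto v l (𝓝 0))
    (i : ι) : u i = v i := by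
  have h1 : Tendsto (fun j => u j - v j) l (𝓝 (u i - v i)) :=
    tendsto_const_nhds.congr fun j => hconst i j
  have h2 := hu.sub hv
  rw [sub_zero] at h2
  exact sub_eq_zero.1 (tendsto_nhds_unique h1 h2)

include hC1 hclosed hdecr in
/-- In a chart, the Cauchy transforms in the different fibre variables agree: both vanish at
infinity along the diagonal. -/
lemma localSolution_eq_localSolution (s : S) (δ δ' : Fin k) {p : ZW n k}
    (hp : p ∈ (F.chart s).target) : F.localSolution η s δ p = F.localSolution η s δ' p := by
  obtain ⟨z, w⟩ := p
  have hz : z ∈ F.U s := mem_target.1 hp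
  have htar : ∀ w : Fin k → ℂ, (z, w) ∈ (F.chart s).target := fun w => mem_target.2 hz
  have hconst := localSolution_sub_eq hC1 hclosed hdecr (s := s) (t := s) δ δ' hz hz
    (fun w => (F.chart s).map_target (htar w)) (fun w => by rw [(F.chart s).right_inv (htar w)])
  simp only [(F.chart s).right_inv (htar _)] at hconst
  have hlim : ∀ δ : Fin k, Tendsto (fun w => F.localSolution η s δ (z, w))
      (map (fun τ : ℝ => fun _ : Fin k => (τ : ℂ)) atTop) (𝓝 0) := by
    intro δ
    rw [tendsto_map'_iff, Metric.tendsto_nhds]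
    intro θ hθ
    obtain ⟨M, -, hM⟩ := exists_forall_localSolution_lt hdecr s δ (K := {z}) (by simpa using hz)
      isCompact_singleton hθ
    filter_upwards [eventually_ge_atTop M] with τ hτ
    rw [dist_zero_right]
    refine hM _ rfl ?_
    simpa using hτ.trans (le_abs_self τ)
  exact eq_of_sub_const_of_tendsto hconst (hlim δ) (hlim δ') w

include hC1 hclosed hdecr in
lemma tendsto_localSolution_cobounded (s : S) (δ : Fin k) {z : Fin n → ℂ} (hz : z ∈ F.U s) :
    Tendsto (fun w => F.localSolution η s δ (z, w)) (Bornology.cobounded (Fin k → ℂ)) (𝓝 0) := by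
  rw [Metric.tendsto_nhds]
  intro θ hθ
  choose M hM0 hM using fun γ => exists_forall_localSolution_lt hdecr s γ (K := {z})
    (by simpa using hz) isCompact_singleton hθ
  have hbig : ∀ᶠ w : Fin k → ℂ in Bornology.cobounded _, 1 + ∑ γ, M γ ≤ ‖w‖ :=
    tendsto_norm_cobounded_atTop.eventually_ge_atTop _
  filter_upwards [hbig] with w hw
  have hsum : 0 ≤ ∑ γ, M γ := Finset.sum_nonneg fun γ _ => (hM0 γ).le
  obtain ⟨γ, hγ⟩ : ∃ γ, 1 + ∑ γ, M γ ≤ ‖w γ‖ := by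
    by_contra! h
    exact absurd hw (not_le.2 ((pi_norm_lt_iff (by linarith)).2 h))
  rw [dist_zero_right, localSolution_eq_localSolution hC1 hclosed hdecr s δ γ (mem_target.2 hz)]
  refine hM γ _ rfl (le_trans ?_ hγ)
  have := Finset.single_le_sum (f := M) (fun γ _ => (hM0 γ).le) (Finset.mem_univ γ)
  linarith

lemma _root_.IsBiholomorphic.tendsto_cobounded {g : (Fin k → ℂ) → (Fin k → ℂ)}
    (hg : IsBiholomorphic g) :
    Tendsto g (Bornology.cobounded (Fin k → ℂ)) (Bornology.cobounded (Fin k → ℂ)) := by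
  obtain ⟨hgd, h, hh, hl, hr⟩ := hg
  let e : (Fin k → ℂ) ≃ₜ (Fin k → ℂ) := ⟨⟨g, h, hl, hr⟩, hgd.continuous, hh.continuous⟩
  rw [Metric.cobounded_eq_cocompact]
  exact e.isClosedEmbedding.tendsto_cocompact

include hC1 hclosed hdecr in
/-- The local solutions of different charts agree on the overlap: a biholomorphism of `ℂᵏ` is
proper, so both vanish at infinity along the common fibre. -/
lemma localSolution_chart_eq (s t : S) (δ δ' : Fin k) {x : X} (hs : x ∈ (F.chart s).source)
    (ht : x ∈ (F.chart t).source) :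
    F.localSolution η t δ (F.chart t x) = F.localSolution η s δ' (F.chart s x) := by
  obtain ⟨f, g, hfg⟩ := F.transition s t
  obtain ⟨hg, htr⟩ := hfg x ⟨hs, ht⟩
  set z := (F.chart t x).1
  have hz : z ∈ F.U t := mem_target.1 ((F.chart t).map_source ht)
  have hfst : ∀ w : Fin k → ℂ, (F.chart s ((F.chart t).symm (z, w))).1 = f z := fun w => by
    rw [(htr w).2]
  have hz' : f z ∈ F.U s := by
    rw [← hfst 0]
    exact mem_target.1 ((F.chart s).map_source (htr 0).1)
  have hconst := localSolution_sub_eq hC1 hclosed hdecr δ δ' hz hz' (fun w => (htr w).1) hfst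
  have : Nonempty (Fin k) := ⟨δ⟩
  have hlim : Tendsto (fun w => F.localSolution η s δ' (F.chart s ((F.chart t).symm (z, w))))
      (Bornology.cobounded (Fin k → ℂ)) (𝓝 0) := by
    simp only [(htr _).2]
    exact (tendsto_localSolution_cobounded hC1 hclosed hdecr s δ' hz').comp hg.tendsto_cobounded
  have h := eq_of_sub_const_of_tendsto hconst
    (tendsto_localSolution_cobounded hC1 hclosed hdecr t δ hz) hlim (F.chart t x).2
  rw [show (z, (F.chart t x).2) = F.chart t x from rfl, (F.chart t).left_inv ht] at h
  exact h

include hC1 hclosed hdecr in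
lemma exists_global_solution (hk : 1 ≤ k) : ∃ B : X → ℂ, ∀ s, ∀ p ∈ (F.chart s).target,
    ∀ δ : Fin k, B ((F.chart s).symm p) = F.localSolution η s δ p := by
  choose c hc using F.cover
  refine ⟨fun x => F.localSolution η (c x) ⟨0, hk⟩ (F.chart (c x) x), fun s p hp δ => ?_⟩
  refine (localSolution_chart_eq hC1 hclosed hdecr s _ _ δ ((F.chart s).map_target hp)
    (hc _)).trans ?_
  rw [(F.chart s).right_inv hp]

end HolomorphicFiberBundle
end

open MeasureTheory HolomorphicFiberBundle in
theorem theorem2 {n k : ℕ} (hn : 1 ≤ n) (hk : 1 ≤ k)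
    {X : Type*} [TopologicalSpace X] [T2Space X] [ConnectedSpace X]
    [ChartedSpace (ZW n k) X] [IsManifold 𝓘(ℂ, ZW n k) ω X]
    {S : Type*} (F : HolomorphicFiberBundle n k X S)
    (η : ZeroOneForm n k X) (hC1 : F.IsC1Form η) (hclosed : F.IsDbarClosed η)
    (hdecr : F.IsDecreasing η) :
    ∃ B : X → ℂ, ContMDiff 𝓘(ℝ, ZW n k) 𝓘(ℝ, ℂ) 1 B ∧
      -- 1. `B` solves the equation
      dbar B = η ∧
      -- in each chart, `B` is the Cauchy transform of `b_δ` in the variable `w_δ`, for every `δ`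
      (∀ s, ∀ p ∈ (F.chart s).target, ∀ δ : Fin k,
        MeasureTheory.Integrable (cauchyIntegrand δ (F.bCoeff η s δ) p) ∧
        B ((F.chart s).symm p) =
          1 / (2 * Real.pi * Complex.I) *
            wedgeIntegral (cauchyIntegrand δ (F.bCoeff η s δ) p)) ∧
      -- 2. the estimate by an explicit integral, with the exponent of the decay of the `b_γ`
      (∀ s, ∀ K ⊆ F.U s, IsCompact K → ∀ ε > (0 : ℝ), ∀ C : ℝ, F.BDecay η s K ε C →
        ∃ C' : ℝ, ∀ δ : Fin k, ∀ z ∈ K, ∀ w : Fin k → ℂ,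
          MeasureTheory.Integrable (boundIntegrand δ ε w) ∧
          ‖B ((F.chart s).symm (z, w))‖ ≤ C' * absWedgeIntegral (boundIntegrand δ ε w)) ∧
      -- 3. `B` is bounded in each chart, uniformly for `z` in a compact set
      (∀ s, ∀ K ⊆ F.U s, IsCompact K →
        ∃ M : ℝ, ∀ z ∈ K, ∀ w : Fin k → ℂ, ‖B ((F.chart s).symm (z, w))‖ ≤ M) ∧
      -- 4. `B → 0` as `|w_δ| → ∞`, uniformly in `z` in a compact set and in the other `w_γ`
      (∀ s, ∀ K ⊆ F.U s, IsCompact K → ∀ δ : Fin k, ∀ θ > (0 : ℝ), ∃ M > (0 : ℝ),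
        ∀ z ∈ K, ∀ w : Fin k → ℂ, M ≤ ‖w δ‖ →
          ‖B ((F.chart s).symm (z, w))‖ < θ) := by
  obtain ⟨B, hB⟩ := exists_global_solution hC1 hclosed hdecr hk
  let δ₀ : Fin k := ⟨0, hk⟩
  have hchart : ∀ s, ∀ p ∈ (F.chart s).target,
      ContMDiffAt 𝓘(ℝ, ZW n k) 𝓘(ℝ, ℂ) 1 B ((F.chart s).symm p) ∧
      ∀ v : ZW n k, dbar B ((F.chart s).symm p)
        (mfderiv 𝓘(ℂ, ZW n k) 𝓘(ℂ, ZW n k) (F.chart s).symm p v) =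
          antilinearPart (fderiv ℝ (F.localSolution η s δ₀) p) v := fun s p hp =>
    contMDiffAt_and_dbar_of_eqOn_chart (F.chart_mem s) hp
      (contDiffAt_localSolution hC1 hdecr s δ₀ hp) fun q hq => hB s q hq δ₀
  have htar : ∀ s, ∀ K ⊆ F.U s, ∀ z ∈ K, ∀ w : Fin k → ℂ, (z, w) ∈ (F.chart s).target :=
    fun s K hK z hz w => mem_target.2 (hK hz)
  refine ⟨B, fun x => ?_, ?_, fun s p hp δ => ⟨?_, hB s p hp δ⟩, ?_, ?_, ?_⟩
  · obtain ⟨s, hs⟩ := F.cover x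
    have h := (hchart s _ ((F.chart s).map_source hs)).1
    rwa [(F.chart s).left_inv hs] at h
  · funext x
    obtain ⟨s, hs⟩ := F.cover x
    obtain ⟨p, hp, rfl⟩ : ∃ p ∈ (F.chart s).target, (F.chart s).symm p = x :=
      ⟨_, (F.chart s).map_source hs, (F.chart s).left_inv hs⟩
    ext v
    -- every tangent vector at `x` is the image of a vector of the model space
    obtain ⟨u, rfl⟩ := (mdifferentiable_of_mem_maximalAtlas
      (F.chart_mem s)).symm.mfderiv_surjective hp v
    exact ((hchart s p hp).2 u).trans
      (antilinearPart_fderiv_localSolution hC1 hclosed hdecr s δ₀ hp u)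
  · exact (integrable_cauchyIntegrand_iff _ _ _).2 ((hdecr.locallyFiberDecay s δ).integrable
      (hC1.contDiffOn_bCoeff s δ) δ (mem_target.1 hp))
  · intro s K hK _ ε hε C hC
    refine ⟨C / (2 * Real.pi), fun δ z hz w => ⟨integrable_boundIntegrand δ hε w, ?_⟩⟩
    rw [hB s _ (htar s K hK z hz w) δ]
    exact (show FiberDecay _ K ε C from hC δ).norm_cauchyTransform_le hε δ (p := (z, w)) hz
  · intro s K hK hKc
    obtain ⟨M, hM⟩ := exists_bound_localSolution hdecr s δ₀ hK hKc
    refine ⟨M, fun z hz w => ?_⟩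
    rw [hB s _ (htar s K hK z hz w) δ₀]
    exact hM _ hz
  · intro s K hK hKc δ θ hθ
    obtain ⟨M, hM0, hM⟩ := exists_forall_localSolution_lt hdecr s δ hK hKc hθ
    refine ⟨M, hM0, fun z hz w hw => ?_⟩
    rw [hB s _ (htar s K hK z hz w) δ]
    exact hM _ hz hw
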